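/- For real $x,y,z$ let $$Q(x,y,z)=\int_{-\infty}^{\infty}\exp\bigl[i(\tfrac15t^5+\tfrac13xt^3+\tfrac12yt^2+zt)\bigr]\,dt$$ be the (rescaled) swallowtail integral, taken as a conditionally convergent improper integral, and let $f_-(t)=\tfrac15t^5-t$, whose saddle points are $\pm1,\pm i$. For $z<0$ put $\lambda=|z|^{5/4}$. (1) For $z<0$ the integral $Q(0,0,z)$ converges, and as $z\to-\infty$, to leading order, $$Q(0,0,z)=|z|^{1/4}\sqrt{\frac{2\pi}{\lambda}}\,\Bigl(\cos\bigl(\tfrac{4\lambda}5-\tfrac\pi4\bigr)+o(1)\Bigr).$$ (2) There are piecewise $C^1$ contours $\Gamma_2$ from $\infty e^{9\pi i/10}$ to $\infty e^{13\pi i/10}$ through $-1$, $\Gamma_3$ from $\infty e^{13\pi i/10}$ to $\infty e^{17\pi i/10}$ through $-i$, and $\Gamma_0$ from $\infty e^{17\pi i/10}$ to $\infty e^{\pi i/10}$ through $1$, on each of which $\operatorname{Re}(if_-)$ takes its maximum only at the saddle. For all piecewise $C^1$ contours $\Gamma_2,\Gamma_3,\Gamma_0$ with these respective end directions, the integrals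 $J_k(\lambda)=\int_{\Gamma_k}e^{i\lambda f_-(t)}\,dt$ converge for $\lambda>0$, and for $z<0$ $$Q(0,0,z)=|z|^{1/4}\bigl(J_2(\lambda)+J_3(\lambda)+J_0(\lambda)\bigr),\qquad \lambda=|z|^{5/4}.$$ As $\lambda\to+\infty$, $$J_0(\lambda)\sim\sqrt{\tfrac{\pi}{2\lambda}}\,e^{-4\lambda i/5+\pi i/4},\qquad J_2(\lambda)\sim\sqrt{\tfrac{\pi}{2\lambda}}\,e^{4\lambda i/5-\pi i/4},\qquad J_3(\lambda)\sim\sqrt{\tfrac{\pi}{2\lambda}}\,e^{-4\lambda/5}.$$ Thus the real saddles $\pm1$ dominate, and the contribution of the saddle $-i$ is exponentially negligible: $J_3(\lambda)=O(e^{-4\lambda/5}J_0(\lambda))$ and $J_3(\lambda)=O(e^{-4\lambda/5}J_2(\lambda))$. (3) The large negative zeroes of $z\mapsto Q(0,0,z)$ can be labelled, one for each large integer $m$, in such a way that, with $\zeta_m$ the zero labelled $m$, $$\tfrac45|\zeta_m|^{5/4}-\tfrac\pi4-(2m+1)\tfrac\pi2\to0,\qquad \zeta_m\sim-\Bigl[\tfrac54\Bigl(\tfrac\pi4+(2m+1)\tfrac\pi2\Bigr)\Bigr]^{4/5}\qquad(m\to\infty).$$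 Precisely: there are $M\in\mathbb N$ and real numbers $0>\zeta_M>\zeta_{M+1}>\cdots$ with these two properties such that the zeroes of $Q(0,0,\cdot)$ in $(-\infty,\zeta_M]$ are exactly the $\zeta_m$, $m\ge M$. -/

import Mathlib

open Filter Topology Asymptotics MeasureTheory

noncomputable section

/-- The integral of `g` over `[p.1, p.2]`. The improper integral over the real line is its limit as
`p.1 → -∞` and `p.2 → +∞` independently. -/
def truncatedIntegral (g : ℝ → ℂ) (p : ℝ × ℝ) : ℂ :=
  ∫ t in p.1..p.2, g t

/-- `g` has a (possibly only conditionally) convergent integral over the real line, of value `v`. -/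
def HasImproperIntegral (g : ℝ → ℂ) (v : ℂ) : Prop :=
  Tendsto (truncatedIntegral g) (atBot ×ˢ atTop) (𝓝 v)

/-- The value of the improper integral of `g` over the real line (meaningful when
`HasImproperIntegral g v` holds for some `v`). -/
def improperIntegral (g : ℝ → ℂ) : ℂ :=
  limUnder (atBot ×ˢ atTop) (truncatedIntegral g)

/-- The integrand `exp[i(t⁵/5 + x t³/3 + y t²/2 + z t)]` of the rescaled swallowtail integral. -/
def swallowtailIntegrand (x y z t : ℝ) : ℂ :=
  Complex.exp (Complex.I * ((t ^ 5 / 5 + x * t ^ 3 / 3 + y * t ^ 2 / 2 + z * t : ℝ) : ℂ))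

/-- The (rescaled) swallowtail integral `Q(x, y, z)`. -/
def swallowtailQ (x y z : ℝ) : ℂ :=
  improperIntegral (swallowtailIntegrand x y z)

/-- The phase function `f₋(t) = t⁵/5 - t`; its saddles are `1, i, -1, -i`. -/
def fMinus (t : ℂ) : ℂ :=
  t ^ 5 / 5 - t

/-- `γ` is a piecewise continuously differentiable, locally rectifiable contour in the complex plane
that begins at `∞ e^{iα}` and ends at `∞ e^{iβ}`. -/
structure IsContour (γ : ℝ → ℂ) (α β : ℝ) : Prop where
  continuous : Continuous γ
  piecewise_smooth : ∃ S : Set ℝ, S.Finite ∧ ∀ s ∉ S, ContDiffAt ℝ 1 γ s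
  locally_rectifiable : LocallyIntegrable (deriv γ) volume
  norm_atBot : Tendsto (fun s => ‖γ s‖) atBot atTop
  norm_atTop : Tendsto (fun s => ‖γ s‖) atTop atTop
  direction_atBot : Tendsto (fun s => γ s / (‖γ s‖ : ℂ)) atBot (𝓝 (Complex.exp (α * Complex.I)))
  direction_atTop : Tendsto (fun s => γ s / (‖γ s‖ : ℂ)) atTop (𝓝 (Complex.exp (β * Complex.I)))

/-- A contour from `∞ e^{iα}` to `∞ e^{iβ}` through `t₀` along which `|exp(iλ f₋(t))|`, for `λ > 0`,
takes its maximum exactly once, at `t₀`. -/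
structure IsSaddleContour (γ : ℝ → ℂ) (t₀ : ℂ) (α β : ℝ) : Prop where
  isContour : IsContour γ α β
  through : γ 0 = t₀
  descent : ∀ s : ℝ, s ≠ 0 → (Complex.I * fMinus (γ s)).re < (Complex.I * fMinus t₀).re

/-- The integrand of `∫_γ exp(iλ f₋(t)) dt`, pulled back to the parameter line. -/
def saddleIntegrand (γ : ℝ → ℂ) (lam : ℝ) (s : ℝ) : ℂ :=
  Complex.exp (Complex.I * lam * fMinus (γ s)) * deriv γ s

/-- The contour integral `∫_γ exp(iλ f₋(t)) dt`. -/
def saddleIntegral (γ : ℝ → ℂ) (lam : ℝ) : ℂ :=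
  improperIntegral (saddleIntegrand γ lam)

/-- The approximate negative zeroes `-[(5/4)(π/4 + (2m+1)π/2)]^{4/5}`. -/
def approxNegZero (m : ℕ) : ℝ :=
  -((5 / 4 * (Real.pi / 4 + (2 * (m : ℝ) + 1) * Real.pi / 2)) ^ (4 / 5 : ℝ))

end

/-! Contour deformation is replaced by an entire primitive `F` of `exp(iλf₋)`. Since `f₋` is odd
with real coefficients, `F` can be normalized so that `F(-conj t) = -conj F(t)`. In a convex cone
where `Im f₋ ≥ 0` far out, `F` has one limit at infinity (`exists_tendsto_primitive`), so every
contour integral is a difference of valley limits, whatever the contour. Two limits suffice: `VE` in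
a cone holding both the positive real axis and the direction `π/10`, and `VP` in a cone about
`17π/10`. Reflection gives `-conj VE` and `-conj VP` on the left. Hence `J₀ = VE - VP`, `J₂ = conj
(VE - VP)`, `J₃ = 2 Re VP`, and scaling by `|z|^{1/4}` gives `Q = |z|^{1/4} · 2 Re VE`. The
decomposition of `Q` is then an algebraic identity.

For the asymptotics, `VE - F(1)`, `VP - F(1)` and `VP - F(-i)` are computed along explicit half
parabolas leaving the saddle, on which the real part of the exponent is at most `-c s²`. Laplace's
method (`tendsto_laplace`) gives each leading term, with half of a Gaussian integral from each half
path. Moreover `Re F(-i) = 0`, because `-i` is fixed by the reflection.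

For the zeroes, closeness to the cosine gives existence but not uniqueness. The Laplace integrals
are therefore also differentiated in `λ` (`IsHalfPath.exists_deriv`): the normalized `Q` is
`C¹`-close to `cos(4λ/5 - π/4)`, so each half period far out contains exactly one zero. -/

/-! ### The phase, its reflection symmetry and a symmetric primitive -/

theorem hasDerivAt_fMinus (t : ℂ) : HasDerivAt fMinus (t ^ 4 - 1) t := by
  have h := ((hasDerivAt_pow 5 t).div_const 5).sub (hasDerivAt_id t)
  refine (h.congr_deriv ?_).congr_of_eventuallyEq (Eventually.of_forall fun s => ?_)
  · norm_num
  · simp [fMinus]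

theorem continuous_fMinus : Continuous fMinus := by
  unfold fMinus
  fun_prop

theorem fMinus_im (t : ℂ) :
    (fMinus t).im = t.im * (t.re ^ 4 - 2 * t.re ^ 2 * t.im ^ 2 + t.im ^ 4 / 5 - 1) := by
  have h5 : ((5 : ℂ)) = ((5 : ℝ) : ℂ) := by norm_num
  unfold fMinus
  rw [h5, Complex.sub_im, Complex.div_ofReal_im]
  simp only [pow_succ, pow_zero, one_mul, Complex.mul_im, Complex.mul_re]
  ring

theorem fMinus_neg_conj (t : ℂ) :
    fMinus (-(starRingEnd ℂ) t) = -(starRingEnd ℂ) (fMinus t) := by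
  simp only [fMinus, map_sub, map_div₀, map_pow, Complex.conj_ofNat]
  ring

theorem hasDerivAt_cexp_fMinus (lam : ℝ) (t : ℂ) :
    HasDerivAt (fun t => Complex.exp (Complex.I * lam * fMinus t))
      (Complex.exp (Complex.I * lam * fMinus t) * (Complex.I * lam * (t ^ 4 - 1))) t :=
  ((hasDerivAt_fMinus t).const_mul (Complex.I * lam)).cexp

theorem norm_cexp_fMinus (lam : ℝ) (t : ℂ) :
    ‖Complex.exp (Complex.I * lam * fMinus t)‖ = Real.exp (-(lam * (fMinus t).im)) := by
  rw [Complex.norm_exp]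
  congr 1
  simp [Complex.mul_re]

/-- An entire primitive of `exp (iλ f₋)` that respects the reflection in the imaginary axis. -/
structure IsPhasePrimitive (lam : ℝ) (F : ℂ → ℂ) : Prop where
  hasDerivAt : ∀ t, HasDerivAt F (Complex.exp (Complex.I * lam * fMinus t)) t
  neg_conj : ∀ t, F (-(starRingEnd ℂ) t) = -(starRingEnd ℂ) (F t)

theorem exists_isPhasePrimitive (lam : ℝ) : ∃ F, IsPhasePrimitive lam F := by
  have hd : Differentiable ℂ (fun t => Complex.exp (Complex.I * lam * fMinus t)) :=
    fun t => (hasDerivAt_cexp_fMinus lam t).differentiableAt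
  obtain ⟨F₀, hF₀⟩ := hd.isExactOn_univ
  set F : ℂ → ℂ := fun t => F₀ t - F₀ 0 with hFdef
  have hF : ∀ t, HasDerivAt F (Complex.exp (Complex.I * lam * fMinus t)) t :=
    fun t => (hF₀ t (Set.mem_univ t)).sub_const _
  refine ⟨F, hF, ?_⟩
  -- The defect of the symmetry. Its derivative vanishes because the integrand is itself symmetric,
  -- and it is zero at the origin because of the normalization `F 0 = 0`.
  set D : ℂ → ℂ := fun t => F t + (starRingEnd ℂ) (F ((starRingEnd ℂ) (-t))) with hD
  have hDd : ∀ t, HasDerivAt D 0 t := by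
    intro t
    have h1 : HasDerivAt (fun s => (starRingEnd ℂ) (F ((starRingEnd ℂ) s)))
        ((starRingEnd ℂ) (Complex.exp (Complex.I * lam * fMinus ((starRingEnd ℂ) (-t))))) (-t) :=
      (hF ((starRingEnd ℂ) (-t))).star_conj.congr_deriv (by simp) |> fun h => by
        simpa [Function.comp_def] using h
    have h2 := (hF t).add (h1.comp t (hasDerivAt_neg t))
    refine h2.congr_deriv ?_
    rw [← Complex.exp_conj, map_neg, fMinus_neg_conj]
    simp
  have hconst : ∀ t, D t = D 0 := fun t =>
    is_const_of_deriv_eq_zero (fun s => (hDd s).differentiableAt) (fun s => (hDd s).deriv) t 0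
  intro t
  have h := hconst ((starRingEnd ℂ) (-t))
  simp only [hD, hFdef, map_neg, neg_neg, Complex.conj_conj, sub_self, map_zero, neg_zero,
    add_zero] at h ⊢
  simpa using eq_neg_of_add_eq_zero_left h

/-! ### Limits of the primitive in the valleys -/

/-- `exp (iλ f₋)` has a limiting primitive in a convex cone where it stays bounded. -/
theorem exists_tendsto_primitive {lam : ℝ} (hlam : 0 < lam) {F : ℂ → ℂ}
    (hF : ∀ t, HasDerivAt F (Complex.exp (Complex.I * lam * fMinus t)) t) {K : Set ℂ}
    (hK : Convex ℝ K) (h0 : (0 : ℂ) ∉ K) (hcone : ∀ t ∈ K, ∀ r : ℝ, 0 < r → (r : ℂ) * t ∈ K)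
    (him : ∀ t ∈ K, 2 ≤ ‖t‖ → 0 ≤ (fMinus t).im) :
    ∃ V, Tendsto F (Bornology.cobounded ℂ ⊓ 𝓟 K) (𝓝 V) := by
  -- The boundary term of one integration by parts. `F - R` has derivative of order `t⁻⁵` even where
  -- the exponential is only bounded, as on the real axis.
  set R : ℂ → ℂ := fun t =>
    Complex.exp (Complex.I * lam * fMinus t) / (Complex.I * lam * (t ^ 4 - 1)) with hR
  have hlamC : (Complex.I * lam : ℂ) ≠ 0 :=
    mul_ne_zero Complex.I_ne_zero (Complex.ofReal_ne_zero.2 hlam.ne')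
  have hexp : ∀ t ∈ K, 2 ≤ ‖t‖ → ‖Complex.exp (Complex.I * lam * fMinus t)‖ ≤ 1 := by
    intro t ht h2
    rw [norm_cexp_fMinus, Real.exp_le_one_iff, neg_nonpos]
    exact mul_nonneg hlam.le (him t ht h2)
  have hden : ∀ t : ℂ, 2 ≤ ‖t‖ → ‖t‖ ^ 4 / 2 ≤ ‖t ^ 4 - 1‖ := by
    intro t h2
    have h := norm_sub_norm_le (t ^ 4) 1
    rw [norm_pow, norm_one] at h
    have : (2 : ℝ) ^ 4 ≤ ‖t‖ ^ 4 := by gcongr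
    linarith
  have hden0 : ∀ t : ℂ, 2 ≤ ‖t‖ → t ^ 4 - 1 ≠ 0 := by
    intro t h2 h
    have h3 := hden t h2
    rw [h, norm_zero] at h3
    have : (2 : ℝ) ^ 4 ≤ ‖t‖ ^ 4 := by gcongr
    linarith
  set G : ℂ → ℂ := fun t => F t - R t with hG
  have hGd : ∀ t : ℂ, 2 ≤ ‖t‖ → HasDerivAt G
      (Complex.exp (Complex.I * lam * fMinus t) * (4 * t ^ 3) /
        (Complex.I * lam * (t ^ 4 - 1) ^ 2)) t := by
    intro t h2
    have hne := hden0 t h2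
    have h1 : HasDerivAt (fun t : ℂ => Complex.I * lam * (t ^ 4 - 1))
        (Complex.I * lam * (4 * t ^ 3)) t := by
      have := (((hasDerivAt_pow 4 t).sub_const 1).const_mul (Complex.I * lam : ℂ))
      simpa using this
    have h3 := (hF t).sub ((hasDerivAt_cexp_fMinus lam t).div h1 (mul_ne_zero hlamC hne))
    refine h3.congr_deriv ?_
    have hl : (lam : ℂ) ≠ 0 := Complex.ofReal_ne_zero.2 hlam.ne'
    have hI := Complex.I_ne_zero
    field_simp
    ring
  -- The image of the far part of `K` under `w = 1/t`. As `w⁻¹` is a positive multiple of `conj w`,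
  -- inversion turns the cone into its conjugate, so this set stays convex, and the ball of radius
  -- `1/2` encodes `‖t‖ ≥ 2`.
  set S : Set ℂ := {w | (starRingEnd ℂ) w ∈ K} ∩ Metric.closedBall 0 (1 / 2) with hS
  have hSconv : Convex ℝ S := by
    refine Convex.inter ?_ (convex_closedBall 0 _)
    exact hK.is_linear_preimage Complex.conjLIE.toLinearEquiv.toLinearMap.isLinear
  have hSK : ∀ w ∈ S, w ≠ 0 ∧ w⁻¹ ∈ K ∧ 2 ≤ ‖w⁻¹‖ := by
    rintro w ⟨hw1, hw2⟩
    have hw0 : w ≠ 0 := by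
      rintro rfl
      exact h0 (by simpa using hw1)
    have hn : 0 < Complex.normSq w := Complex.normSq_pos.2 hw0
    refine ⟨hw0, ?_, ?_⟩
    · rw [Complex.inv_def, mul_comm]
      exact hcone _ hw1 _ (inv_pos.2 hn)
    · rw [norm_inv, le_inv_comm₀ two_pos (norm_pos_iff.2 hw0)]
      simpa using hw2
  -- With `r = ‖w⁻¹‖`, the derivative in `w` is at most `4r³ / (λ(r⁴/2)²) · r² = 16/(λr³)`.
  have hlip : LipschitzOnWith (Real.toNNReal (16 / lam)) (fun w => G w⁻¹) S := by
    refine hSconv.lipschitzOnWith_of_nnnorm_hasDerivWithin_le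
      (f' := fun w => (Complex.exp (Complex.I * lam * fMinus w⁻¹) * (4 * w⁻¹ ^ 3) /
        (Complex.I * lam * (w⁻¹ ^ 4 - 1) ^ 2)) * (-(w ^ 2)⁻¹)) (fun w hw => ?_) (fun w hw => ?_)
    · obtain ⟨hw0, -, h2⟩ := hSK w hw
      exact ((hGd _ h2).comp w (hasDerivAt_inv hw0)).hasDerivWithinAt
    · obtain ⟨hw0, hwK, h2⟩ := hSK w hw
      rw [← NNReal.coe_le_coe, coe_nnnorm, Real.coe_toNNReal _ (by positivity)]
      have he := hexp _ hwK h2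
      have hd := hden _ h2
      rw [norm_mul, norm_div, norm_mul, norm_neg, norm_mul, norm_mul, norm_mul, Complex.norm_I,
        one_mul, ← inv_pow, norm_pow, norm_pow, norm_pow, Complex.norm_real, Real.norm_eq_abs,
        abs_of_pos hlam]
      set r := ‖w⁻¹‖
      have h4 : ‖(4 : ℂ)‖ = 4 := by simp
      rw [h4]
      have hr : (0 : ℝ) < r := by linarith
      calc _ ≤ 1 * (4 * r ^ 3) / (lam * (r ^ 4 / 2) ^ 2) * r ^ 2 := by gcongr
        _ = 16 / lam * (1 / r ^ 3) := by field_simp; ring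
        _ ≤ 16 / lam * 1 := by
          gcongr
          rw [div_le_one (by positivity)]
          exact one_le_pow₀ (by linarith)
        _ = _ := mul_one _
  -- A Lipschitz extension to the whole plane is continuous at `w = 0`, and its value there is the
  -- limit at infinity.
  obtain ⟨g, hg, hgeq⟩ := hlip.extend_finite_dimension
  refine ⟨g 0, ?_⟩
  have hbig : ∀ᶠ t in Bornology.cobounded ℂ ⊓ 𝓟 K, t ∈ K ∧ 2 ≤ ‖t‖ :=
    (eventually_inf_principal.2 (Eventually.of_forall fun _ h => h)).and
      ((tendsto_norm_cobounded_atTop.mono_left inf_le_left).eventually_ge_atTop 2)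
  have hR0 : Tendsto R (Bornology.cobounded ℂ ⊓ 𝓟 K) (𝓝 0) := by
    have hb : Tendsto (fun t : ℂ => 2 / (lam * ‖t‖ ^ 4)) (Bornology.cobounded ℂ ⊓ 𝓟 K) (𝓝 0) := by
      refine Tendsto.div_atTop tendsto_const_nhds ?_
      refine Tendsto.const_mul_atTop hlam ?_
      exact (tendsto_pow_atTop (by norm_num)).comp
        (tendsto_norm_cobounded_atTop.mono_left inf_le_left)
    refine squeeze_zero_norm' ?_ hb
    filter_upwards [hbig] with t ⟨htK, h2⟩
    have he := hexp _ htK h2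
    have hd := hden _ h2
    simp only [hR]
    rw [norm_div, norm_mul, norm_mul, Complex.norm_I, one_mul, Complex.norm_real,
      Real.norm_eq_abs, abs_of_pos hlam]
    have hr : (0 : ℝ) < ‖t‖ := by linarith
    calc _ ≤ 1 / (lam * (‖t‖ ^ 4 / 2)) := by gcongr
      _ = _ := by field_simp
  have hg0 : Tendsto (fun t : ℂ => g t⁻¹) (Bornology.cobounded ℂ ⊓ 𝓟 K) (𝓝 (g 0)) :=
    (hg.continuous.tendsto 0).comp (tendsto_inv₀_cobounded.mono_left inf_le_left)
  have := hg0.add hR0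
  rw [add_zero] at this
  refine this.congr' ?_
  filter_upwards [hbig] with t ⟨htK, h2⟩
  have ht0 : t ≠ 0 := by
    rintro rfl
    exact h0 htK
  have htS : t⁻¹ ∈ S := by
    refine ⟨?_, ?_⟩
    · have hn : 0 < Complex.normSq t := Complex.normSq_pos.2 ht0
      have : (starRingEnd ℂ) t⁻¹ = (((Complex.normSq t)⁻¹ : ℝ) : ℂ) * t := by
        rw [Complex.inv_def, map_mul, Complex.conj_conj, Complex.conj_ofReal, mul_comm]
      simp only [Set.mem_ofPred_eq, this]
      exact hcone _ htK _ (inv_pos.2 hn)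
    · simp only [mem_closedBall_zero_iff, norm_inv]
      rw [one_div]
      gcongr
  rw [← hgeq htS]
  simp [hG]

/-- A convex cone about the direction `π/10` that contains the positive real axis. -/
def rightValley : Set ℂ := {t | 0 ≤ t.im ∧ 2 * t.im ≤ t.re ∧ 0 < t.re}

/-- A convex cone about the direction `17π/10`. -/
def lowerValley : Set ℂ := {t | t.re ≤ -t.im ∧ -t.im ≤ 2 * t.re ∧ 0 < t.re}

/-- Write `t = x + iy`. In the cone `4y² ≤ x²`, so `x⁴ - 2x²y² ≥ x⁴/2`, and `‖t‖ ≥ 2` forces `x² ≥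
16/5`, which beats the `-1` in `Im f₋`. -/
theorem exists_tendsto_rightValley {lam : ℝ} (hlam : 0 < lam) {F : ℂ → ℂ}
    (hF : IsPhasePrimitive lam F) :
    ∃ V, Tendsto F (Bornology.cobounded ℂ ⊓ 𝓟 rightValley) (𝓝 V) := by
  refine exists_tendsto_primitive hlam hF.hasDerivAt ?_ (by simp [rightValley]) ?_ ?_
  · rintro x ⟨hx1, hx2, hx3⟩ y ⟨hy1, hy2, hy3⟩ a b ha hb hab
    simp only [rightValley, Set.mem_ofPred_eq, Complex.add_re, Complex.add_im, Complex.real_smul,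
      Complex.re_ofReal_mul, Complex.im_ofReal_mul]
    refine ⟨by positivity, by nlinarith, ?_⟩
    rcases ha.eq_or_lt with rfl | ha
    · obtain rfl : b = 1 := by linarith
      simpa using hy3
    · positivity
  · rintro t ⟨h1, h2, h3⟩ r hr
    simp only [rightValley, Set.mem_ofPred_eq, Complex.re_ofReal_mul, Complex.im_ofReal_mul]
    refine ⟨by positivity, by nlinarith, by positivity⟩
  · rintro t ⟨h1, h2, h3⟩ hn
    rw [fMinus_im]
    have hsq : 4 ≤ t.re ^ 2 + t.im ^ 2 := by
      have := Complex.sq_norm t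
      rw [Complex.normSq_apply] at this
      nlinarith
    have h4 : 4 * t.im ^ 2 ≤ t.re ^ 2 := by nlinarith
    refine mul_nonneg h1 ?_
    nlinarith [sq_nonneg (t.im ^ 2), mul_nonneg (sq_nonneg t.re) (sub_nonneg.2 h4)]

/-- Here `y < 0` and `x² ≤ y² ≤ 4x²`, so `x⁴ - 2x²y² + y⁴/5 ≤ -x²y²/5`. Both factors of `Im f₋` are
nonpositive. -/
theorem exists_tendsto_lowerValley {lam : ℝ} (hlam : 0 < lam) {F : ℂ → ℂ}
    (hF : IsPhasePrimitive lam F) :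
    ∃ V, Tendsto F (Bornology.cobounded ℂ ⊓ 𝓟 lowerValley) (𝓝 V) := by
  refine exists_tendsto_primitive hlam hF.hasDerivAt ?_ (by simp [lowerValley]) ?_ ?_
  · rintro x ⟨hx1, hx2, hx3⟩ y ⟨hy1, hy2, hy3⟩ a b ha hb hab
    simp only [lowerValley, Set.mem_ofPred_eq, Complex.add_re, Complex.add_im, Complex.real_smul,
      Complex.re_ofReal_mul, Complex.im_ofReal_mul]
    refine ⟨by nlinarith, by nlinarith, ?_⟩
    rcases ha.eq_or_lt with rfl | ha
    · obtain rfl : b = 1 := by linarith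
      simpa using hy3
    · positivity
  · rintro t ⟨h1, h2, h3⟩ r hr
    simp only [lowerValley, Set.mem_ofPred_eq, Complex.re_ofReal_mul, Complex.im_ofReal_mul]
    refine ⟨by nlinarith, by nlinarith, by positivity⟩
  · rintro t ⟨h1, h2, h3⟩ hn
    rw [fMinus_im]
    have h4 : t.im ^ 2 ≤ 4 * t.re ^ 2 := by nlinarith
    refine mul_nonneg_of_nonpos_of_nonpos (by linarith) ?_
    have h5 : t.re ^ 2 ≤ t.im ^ 2 := by nlinarith
    nlinarith [mul_nonneg (sq_nonneg t.im) (sub_nonneg.2 h4),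
      mul_nonneg (sq_nonneg t.re) (sub_nonneg.2 h5)]

/-! ### Contour integrals as differences of limits of the primitive -/

theorem HasImproperIntegral.improperIntegral_eq {g : ℝ → ℂ} {v : ℂ}
    (h : HasImproperIntegral g v) : improperIntegral g = v :=
  Tendsto.limUnder_eq h

theorem HasImproperIntegral.self {g : ℝ → ℂ} {v : ℂ} (h : HasImproperIntegral g v) :
    HasImproperIntegral g (improperIntegral g) := by
  rwa [h.improperIntegral_eq]

theorem hasImproperIntegral_of_primitive {g F : ℝ → ℂ} {a b : ℂ}
    (h : ∀ p, truncatedIntegral g p = F p.2 - F p.1)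
    (ha : Tendsto F atBot (𝓝 a)) (hb : Tendsto F atTop (𝓝 b)) :
    HasImproperIntegral g (b - a) := by
  unfold HasImproperIntegral
  rw [funext h]
  exact (hb.comp tendsto_snd).sub (ha.comp tendsto_fst)

/-- The fundamental theorem of calculus with a finite exceptional set. Local rectifiability supplies
the integrability of the derivative that it requires. -/
theorem IsContour.truncatedIntegral_eq {γ : ℝ → ℂ} {α β : ℝ} (hγ : IsContour γ α β) {lam : ℝ}
    {F : ℂ → ℂ} (hF : IsPhasePrimitive lam F) (p : ℝ × ℝ) :
    truncatedIntegral (saddleIntegrand γ lam) p = F (γ p.2) - F (γ p.1) := by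
  obtain ⟨S, hS, hsm⟩ := hγ.piecewise_smooth
  have hFc : Continuous F := continuous_iff_continuousAt.2 fun t => (hF.hasDerivAt t).continuousAt
  refine integral_eq_of_hasDerivAt_off_countable (fun s => F (γ s)) _ hS.countable
    (hFc.comp hγ.continuous).continuousOn (fun s hs => ?_) ?_
  · have hd := ((hsm s hs.2).differentiableAt one_ne_zero).hasDerivAt
    exact (hF.hasDerivAt (γ s)).comp s hd
  · have hi : IntervalIntegrable (deriv γ) volume p.1 p.2 :=
      (hγ.locally_rectifiable.integrableOn_isCompact isCompact_uIcc).intervalIntegrable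
    refine hi.continuousOn_mul (g := fun s => Complex.exp (Complex.I * lam * fMinus (γ s))) ?_
    have := hγ.continuous
    have := continuous_fMinus
    exact Continuous.continuousOn (by fun_prop)

theorem IsContour.hasImproperIntegral {γ : ℝ → ℂ} {α β : ℝ} (hγ : IsContour γ α β) {lam : ℝ}
    {F : ℂ → ℂ} (hF : IsPhasePrimitive lam F) {a b : ℂ}
    (ha : Tendsto (fun s => F (γ s)) atBot (𝓝 a)) (hb : Tendsto (fun s => F (γ s)) atTop (𝓝 b)) :
    HasImproperIntegral (saddleIntegrand γ lam) (b - a) :=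
  hasImproperIntegral_of_primitive (hγ.truncatedIntegral_eq hF) ha hb

/-- The limits of a primitive in the two valleys of the right half plane. -/
structure HasValleyLimits (F : ℂ → ℂ) (VE VP : ℂ) : Prop where
  right : Tendsto F (Bornology.cobounded ℂ ⊓ 𝓟 rightValley) (𝓝 VE)
  lower : Tendsto F (Bornology.cobounded ℂ ⊓ 𝓟 lowerValley) (𝓝 VP)

theorem exists_hasValleyLimits {lam : ℝ} (hlam : 0 < lam) {F : ℂ → ℂ}
    (hF : IsPhasePrimitive lam F) : ∃ VE VP, HasValleyLimits F VE VP := by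
  obtain ⟨VE, hE⟩ := exists_tendsto_rightValley hlam hF
  obtain ⟨VP, hP⟩ := exists_tendsto_lowerValley hlam hF
  exact ⟨VE, VP, hE, hP⟩

/-! ### Trigonometric bounds and directions of approach -/

theorem sin_three_pi_div_ten : Real.sin (3 * Real.pi / 10) = (1 + √5) / 4 := by
  rw [← Real.cos_pi_div_five, ← Real.sin_pi_div_two_sub]
  congr 1
  ring

theorem sin_three_pi_div_ten_bounds :
    0.809 < Real.sin (3 * Real.pi / 10) ∧ Real.sin (3 * Real.pi / 10) < 0.8091 := by
  rw [sin_three_pi_div_ten]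
  have h1 : (2.236 : ℝ) < √5 := Real.lt_sqrt_of_sq_lt (by norm_num)
  have h2 : √5 < 2.2361 := by
    rw [Real.sqrt_lt' (by norm_num)]
    norm_num
  constructor <;> linarith

theorem cos_three_pi_div_ten_bounds :
    0.587 < Real.cos (3 * Real.pi / 10) ∧ Real.cos (3 * Real.pi / 10) < 0.588 := by
  obtain ⟨h1, h2⟩ := sin_three_pi_div_ten_bounds
  have h3 := Real.cos_sq_add_sin_sq (3 * Real.pi / 10)
  have h0 : 0 < Real.cos (3 * Real.pi / 10) :=
    Real.cos_pos_of_mem_Ioo ⟨by linarith [Real.pi_pos], by linarith [Real.pi_pos]⟩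
  constructor <;> nlinarith

theorem sin_pi_div_ten_bounds :
    0 < Real.sin (Real.pi / 10) ∧ Real.sin (Real.pi / 10) < 0.32 := by
  have := Real.pi_pos
  refine ⟨Real.sin_pos_of_pos_of_lt_pi (by positivity) (by linarith), ?_⟩
  have := Real.sin_lt (x := Real.pi / 10) (by positivity)
  have := Real.pi_lt_d2
  linarith

theorem cos_pi_div_ten_gt : 0.94 < Real.cos (Real.pi / 10) := by
  have h := Real.one_sub_sq_div_two_le_cos (x := Real.pi / 10)
  have := Real.pi_lt_d2
  have := Real.pi_pos
  nlinarith

theorem exp_mul_I_re_im (x : ℝ) : (Complex.exp (x * Complex.I)).re = Real.cos x ∧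
    (Complex.exp (x * Complex.I)).im = Real.sin x :=
  ⟨Complex.exp_ofReal_mul_I_re x, Complex.exp_ofReal_mul_I_im x⟩

theorem cos_sin_seventeen_pi_div_ten :
    Real.cos (17 * Real.pi / 10) = Real.cos (3 * Real.pi / 10) ∧
      Real.sin (17 * Real.pi / 10) = -Real.sin (3 * Real.pi / 10) := by
  have h : 17 * Real.pi / 10 = 2 * Real.pi - 3 * Real.pi / 10 := by ring
  rw [h, Real.cos_two_pi_sub, Real.sin_two_pi_sub]
  exact ⟨rfl, rfl⟩

/-- The normalized curve is eventually in the open set `U` around its limit direction. Multiplying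
back by the norm lands in `K`. -/
theorem tendsto_cobounded_inf_of_direction {γ : ℝ → ℂ} {l : Filter ℝ} {u : ℂ} {K U : Set ℂ}
    (hn : Tendsto (fun s => ‖γ s‖) l atTop)
    (hd : Tendsto (fun s => γ s / (‖γ s‖ : ℂ)) l (𝓝 u)) (hU : IsOpen U) (hu : u ∈ U)
    (hUK : ∀ t ∈ U, ∀ r : ℝ, 0 < r → (r : ℂ) * t ∈ K) :
    Tendsto γ l (Bornology.cobounded ℂ ⊓ 𝓟 K) := by
  refine tendsto_inf.2 ⟨tendsto_norm_atTop_iff_cobounded.1 hn, tendsto_principal.2 ?_⟩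
  filter_upwards [hd.eventually (hU.mem_nhds hu), hn.eventually_gt_atTop 0] with s hs hpos
  have := hUK _ hs _ hpos
  rwa [mul_div_cancel₀] at this
  exact Complex.ofReal_ne_zero.2 hpos.ne'

theorem tendsto_rightValley_of_direction {γ : ℝ → ℂ} {l : Filter ℝ}
    (hn : Tendsto (fun s => ‖γ s‖) l atTop)
    (hd : Tendsto (fun s => γ s / (‖γ s‖ : ℂ)) l
      (𝓝 (Complex.exp ((Real.pi / 10 : ℝ) * Complex.I)))) :
    Tendsto γ l (Bornology.cobounded ℂ ⊓ 𝓟 rightValley) := by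
  obtain ⟨h1, h2⟩ := exp_mul_I_re_im (Real.pi / 10)
  obtain ⟨h3, h4⟩ := sin_pi_div_ten_bounds
  have h5 := cos_pi_div_ten_gt
  refine tendsto_cobounded_inf_of_direction (U := {t | 0 < t.im} ∩ {t | 2 * t.im < t.re}) hn hd
    ?_ ?_ ?_
  · exact (isOpen_lt continuous_const Complex.continuous_im).inter
      (isOpen_lt (by fun_prop) Complex.continuous_re)
  · simp only [Set.mem_inter_iff, Set.mem_ofPred_eq, h1, h2]
    constructor <;> linarith
  · rintro t ⟨ht1, ht2⟩ r hr
    simp only [Set.mem_ofPred_eq] at ht1 ht2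
    simp only [rightValley, Set.mem_ofPred_eq, Complex.re_ofReal_mul, Complex.im_ofReal_mul]
    refine ⟨by positivity, by nlinarith, mul_pos hr (by linarith)⟩

theorem tendsto_lowerValley_of_direction {γ : ℝ → ℂ} {l : Filter ℝ}
    (hn : Tendsto (fun s => ‖γ s‖) l atTop)
    (hd : Tendsto (fun s => γ s / (‖γ s‖ : ℂ)) l
      (𝓝 (Complex.exp ((17 * Real.pi / 10 : ℝ) * Complex.I)))) :
    Tendsto γ l (Bornology.cobounded ℂ ⊓ 𝓟 lowerValley) := by
  obtain ⟨h1, h2⟩ := exp_mul_I_re_im (17 * Real.pi / 10)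
  obtain ⟨h3, h4⟩ := cos_sin_seventeen_pi_div_ten
  obtain ⟨h5, h6⟩ := sin_three_pi_div_ten_bounds
  obtain ⟨h7, h8⟩ := cos_three_pi_div_ten_bounds
  refine tendsto_cobounded_inf_of_direction
    (U := {t | t.re < -t.im} ∩ {t | -t.im < 2 * t.re}) hn hd ?_ ?_ ?_
  · exact (isOpen_lt Complex.continuous_re (by fun_prop)).inter
      (isOpen_lt (by fun_prop) (by fun_prop))
  · simp only [Set.mem_inter_iff, Set.mem_ofPred_eq, h1, h2, h3, h4]
    constructor <;> linarith
  · rintro t ⟨ht1, ht2⟩ r hr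
    simp only [Set.mem_ofPred_eq] at ht1 ht2
    simp only [lowerValley, Set.mem_ofPred_eq, Complex.re_ofReal_mul, Complex.im_ofReal_mul]
    refine ⟨by nlinarith, by nlinarith, mul_pos hr (by linarith)⟩

theorem neg_conj_exp_mul_I {x y : ℝ} (h : Real.cos y = -Real.cos x) (h' : Real.sin y = Real.sin x) :
    -(starRingEnd ℂ) (Complex.exp (x * Complex.I)) = Complex.exp (y * Complex.I) := by
  obtain ⟨h1, h2⟩ := exp_mul_I_re_im x
  obtain ⟨h3, h4⟩ := exp_mul_I_re_im y
  apply Complex.ext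
  · rw [Complex.neg_re, Complex.conj_re, h1, h3, h]
  · rw [Complex.neg_im, Complex.conj_im, h2, h4, h', neg_neg]

theorem direction_neg_conj {γ : ℝ → ℂ} {l : Filter ℝ} {x y : ℝ} (h : Real.cos y = -Real.cos x)
    (h' : Real.sin y = Real.sin x)
    (hd : Tendsto (fun s => γ s / (‖γ s‖ : ℂ)) l (𝓝 (Complex.exp (x * Complex.I)))) :
    Tendsto (fun s => -(starRingEnd ℂ) (γ s) / (‖-(starRingEnd ℂ) (γ s)‖ : ℂ)) l
      (𝓝 (Complex.exp (y * Complex.I))) := by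
  rw [← neg_conj_exp_mul_I h h']
  have := ((Complex.continuous_conj.tendsto _).comp hd).neg
  refine this.congr fun s => ?_
  simp [neg_div]

theorem cos_sin_nine_pi_div_ten :
    Real.cos (Real.pi / 10) = -Real.cos (9 * Real.pi / 10) ∧
      Real.sin (Real.pi / 10) = Real.sin (9 * Real.pi / 10) := by
  have h : Real.pi / 10 = Real.pi - 9 * Real.pi / 10 := by ring
  rw [h, Real.cos_pi_sub, Real.sin_pi_sub]
  exact ⟨rfl, rfl⟩

theorem cos_sin_thirteen_pi_div_ten :
    Real.cos (17 * Real.pi / 10) = -Real.cos (13 * Real.pi / 10) ∧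
      Real.sin (17 * Real.pi / 10) = Real.sin (13 * Real.pi / 10) := by
  have h : 17 * Real.pi / 10 = Real.pi - 13 * Real.pi / 10 + 2 * Real.pi := by ring
  rw [h, Real.cos_add_two_pi, Real.sin_add_two_pi, Real.cos_pi_sub, Real.sin_pi_sub]
  exact ⟨rfl, rfl⟩

/-! ### Saddle integrals and `Q` in terms of the two valley limits -/

section ValleyLimits

variable {lam : ℝ} {F : ℂ → ℂ} {VE VP : ℂ} {γ : ℝ → ℂ} {l : Filter ℝ}

theorem HasValleyLimits.tendsto_right (h : HasValleyLimits F VE VP)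
    (hn : Tendsto (fun s => ‖γ s‖) l atTop)
    (hd : Tendsto (fun s => γ s / (‖γ s‖ : ℂ)) l
      (𝓝 (Complex.exp ((Real.pi / 10 : ℝ) * Complex.I)))) :
    Tendsto (fun s => F (γ s)) l (𝓝 VE) :=
  h.right.comp (tendsto_rightValley_of_direction hn hd)

theorem HasValleyLimits.tendsto_lower (h : HasValleyLimits F VE VP)
    (hn : Tendsto (fun s => ‖γ s‖) l atTop)
    (hd : Tendsto (fun s => γ s / (‖γ s‖ : ℂ)) l
      (𝓝 (Complex.exp ((17 * Real.pi / 10 : ℝ) * Complex.I)))) :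
    Tendsto (fun s => F (γ s)) l (𝓝 VP) :=
  h.lower.comp (tendsto_lowerValley_of_direction hn hd)

theorem IsPhasePrimitive.tendsto_of_neg_conj (hF : IsPhasePrimitive lam F) {V : ℂ}
    (h : Tendsto (fun s => F (-(starRingEnd ℂ) (γ s))) l (𝓝 V)) :
    Tendsto (fun s => F (γ s)) l (𝓝 (-(starRingEnd ℂ) V)) := by
  refine ((Complex.continuous_conj.tendsto _).comp h).neg.congr fun s => ?_
  simp [hF.neg_conj]

theorem HasValleyLimits.tendsto_left (h : HasValleyLimits F VE VP) (hF : IsPhasePrimitive lam F)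
    (hn : Tendsto (fun s => ‖γ s‖) l atTop)
    (hd : Tendsto (fun s => γ s / (‖γ s‖ : ℂ)) l
      (𝓝 (Complex.exp ((9 * Real.pi / 10 : ℝ) * Complex.I)))) :
    Tendsto (fun s => F (γ s)) l (𝓝 (-(starRingEnd ℂ) VE)) :=
  hF.tendsto_of_neg_conj (h.tendsto_right (by simpa using hn)
    (direction_neg_conj cos_sin_nine_pi_div_ten.1 cos_sin_nine_pi_div_ten.2 hd))

theorem HasValleyLimits.tendsto_lowerLeft (h : HasValleyLimits F VE VP)
    (hF : IsPhasePrimitive lam F) (hn : Tendsto (fun s => ‖γ s‖) l atTop)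
    (hd : Tendsto (fun s => γ s / (‖γ s‖ : ℂ)) l
      (𝓝 (Complex.exp ((13 * Real.pi / 10 : ℝ) * Complex.I)))) :
    Tendsto (fun s => F (γ s)) l (𝓝 (-(starRingEnd ℂ) VP)) :=
  hF.tendsto_of_neg_conj (h.tendsto_lower (by simpa using hn)
    (direction_neg_conj cos_sin_thirteen_pi_div_ten.1 cos_sin_thirteen_pi_div_ten.2 hd))

theorem HasValleyLimits.saddle_one (h : HasValleyLimits F VE VP) (hF : IsPhasePrimitive lam F)
    (hγ : IsContour γ (17 * Real.pi / 10) (Real.pi / 10)) :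
    HasImproperIntegral (saddleIntegrand γ lam) (VE - VP) :=
  hγ.hasImproperIntegral hF (h.tendsto_lower hγ.norm_atBot hγ.direction_atBot)
    (h.tendsto_right hγ.norm_atTop hγ.direction_atTop)

theorem HasValleyLimits.saddle_neg_one (h : HasValleyLimits F VE VP)
    (hF : IsPhasePrimitive lam F) (hγ : IsContour γ (9 * Real.pi / 10) (13 * Real.pi / 10)) :
    HasImproperIntegral (saddleIntegrand γ lam) ((starRingEnd ℂ) (VE - VP)) := by
  have := hγ.hasImproperIntegral hF (h.tendsto_left hF hγ.norm_atBot hγ.direction_atBot)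
    (h.tendsto_lowerLeft hF hγ.norm_atTop hγ.direction_atTop)
  rwa [neg_sub_neg, ← map_sub] at this

theorem HasValleyLimits.saddle_neg_I (h : HasValleyLimits F VE VP)
    (hF : IsPhasePrimitive lam F) (hγ : IsContour γ (13 * Real.pi / 10) (17 * Real.pi / 10)) :
    HasImproperIntegral (saddleIntegrand γ lam) ((2 * VP.re : ℝ) : ℂ) := by
  have := hγ.hasImproperIntegral hF (h.tendsto_lowerLeft hF hγ.norm_atBot hγ.direction_atBot)
    (h.tendsto_lower hγ.norm_atTop hγ.direction_atTop)
  rwa [sub_neg_eq_add, Complex.add_conj] at this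

/-- With `r = |z|^{1/4}`, `t⁵/5 + zt = r⁵ f₋(t/r)`. The positive real axis lies in the cone
`rightValley`, so the limit along it is already `VE`. This takes the place of rotating the contour
into the direction `π/10`. -/
theorem HasValleyLimits.swallowtail {z : ℝ} (hz : z < 0) (h : HasValleyLimits F VE VP)
    (hF : IsPhasePrimitive (|z| ^ (5 / 4 : ℝ)) F) :
    HasImproperIntegral (swallowtailIntegrand 0 0 z)
      ((|z| ^ (1 / 4 : ℝ) * (2 * VE.re) : ℝ) : ℂ) := by
  have hz0 : 0 < |z| := abs_pos.2 hz.ne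
  set r : ℝ := |z| ^ (1 / 4 : ℝ) with hr
  have hr0 : 0 < r := Real.rpow_pos_of_pos hz0 _
  have hr4 : r ^ 4 = |z| := by
    rw [hr, ← Real.rpow_natCast, ← Real.rpow_mul hz0.le]
    norm_num
  have hr5 : |z| ^ (5 / 4 : ℝ) = r ^ 5 := by
    rw [hr, ← Real.rpow_natCast, ← Real.rpow_mul hz0.le]
    norm_num
  have hzr : z = -r ^ 4 := by rw [hr4, abs_of_neg hz, neg_neg]
  rw [hr5] at hF
  have hder : ∀ t : ℝ, HasDerivAt (fun t : ℝ => (r : ℂ) * F ((t / r : ℝ) : ℂ))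
      (swallowtailIntegrand 0 0 z t) t := by
    intro t
    have h1 : HasDerivAt (fun t : ℝ => ((t / r : ℝ) : ℂ)) ((1 / r : ℝ) : ℂ) t :=
      ((hasDerivAt_id t).div_const r).ofReal_comp
    have h2 := ((hF.hasDerivAt ((t / r : ℝ) : ℂ)).comp t h1).const_mul (r : ℂ)
    refine h2.congr_deriv ?_
    have hrC : (r : ℂ) ≠ 0 := Complex.ofReal_ne_zero.2 hr0.ne'
    unfold swallowtailIntegrand fMinus
    rw [hzr]
    push_cast
    rw [mul_left_comm, mul_one_div_cancel hrC, mul_one]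
    congr 1
    field_simp
    ring
  have htr : ∀ p, truncatedIntegral (swallowtailIntegrand 0 0 z) p =
      (r : ℂ) * F ((p.2 / r : ℝ) : ℂ) - (r : ℂ) * F ((p.1 / r : ℝ) : ℂ) := by
    intro p
    refine intervalIntegral.integral_eq_sub_of_hasDerivAt (fun t _ => hder t) ?_
    refine Continuous.intervalIntegrable ?_ _ _
    unfold swallowtailIntegrand
    fun_prop
  have htop : Tendsto (fun t : ℝ => F ((t / r : ℝ) : ℂ)) atTop (𝓝 VE) := by
    refine h.right.comp (tendsto_inf.2 ⟨tendsto_norm_atTop_iff_cobounded.1 ?_,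
      tendsto_principal.2 ?_⟩)
    · simp only [Complex.norm_real]
      exact tendsto_norm_atTop_atTop.comp (tendsto_id.atTop_div_const hr0)
    · filter_upwards [eventually_gt_atTop 0] with t ht
      simp only [rightValley, Set.mem_ofPred_eq, Complex.ofReal_im, Complex.ofReal_re]
      have : 0 < t / r := by positivity
      refine ⟨le_rfl, by linarith, this⟩
  have hbot : Tendsto (fun t : ℝ => F ((t / r : ℝ) : ℂ)) atBot (𝓝 (-(starRingEnd ℂ) VE)) := by
    refine hF.tendsto_of_neg_conj ((htop.comp tendsto_neg_atBot_atTop).congr fun t => ?_)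
    simp [neg_div]
  have := hasImproperIntegral_of_primitive htr (hbot.const_mul (r : ℂ)) (htop.const_mul (r : ℂ))
  convert this using 1
  rw [← mul_sub, sub_neg_eq_add, Complex.add_conj]
  push_cast
  ring

end ValleyLimits

/-! ### Laplace's method on a half line -/

/-- Polynomial growth on the positive half line. -/
def PolyBounded (g : ℝ → ℂ) : Prop :=
  ∃ (C : ℝ) (n : ℕ), 0 ≤ C ∧ ∀ s, 0 < s → ‖g s‖ ≤ C * (1 + s) ^ n

theorem PolyBounded.const (a : ℂ) : PolyBounded fun _ => a :=
  ⟨‖a‖, 0, norm_nonneg a, fun s _ => by simp⟩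

theorem PolyBounded.ofReal : PolyBounded fun s => (s : ℂ) := by
  refine ⟨1, 1, zero_le_one, fun s hs => ?_⟩
  rw [Complex.norm_real, Real.norm_eq_abs, abs_of_pos hs]
  linarith

theorem PolyBounded.mul {f g : ℝ → ℂ} (hf : PolyBounded f) (hg : PolyBounded g) :
    PolyBounded fun s => f s * g s := by
  obtain ⟨C, n, hC, hf⟩ := hf
  obtain ⟨D, m, hD, hg⟩ := hg
  refine ⟨C * D, n + m, mul_nonneg hC hD, fun s hs => ?_⟩
  rw [norm_mul, pow_add]
  calc _ ≤ (C * (1 + s) ^ n) * (D * (1 + s) ^ m) :=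
        mul_le_mul (hf s hs) (hg s hs) (norm_nonneg _) (by positivity)
    _ = _ := by ring

theorem PolyBounded.add {f g : ℝ → ℂ} (hf : PolyBounded f) (hg : PolyBounded g) :
    PolyBounded fun s => f s + g s := by
  obtain ⟨C, n, hC, hf⟩ := hf
  obtain ⟨D, m, hD, hg⟩ := hg
  refine ⟨C + D, n + m, add_nonneg hC hD, fun s hs => ?_⟩
  have h1 : (1 + s) ^ n ≤ (1 + s) ^ (n + m) := pow_le_pow_right₀ (by linarith) (by omega)
  have h2 : (1 + s) ^ m ≤ (1 + s) ^ (n + m) := pow_le_pow_right₀ (by linarith) (by omega)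
  calc _ ≤ ‖f s‖ + ‖g s‖ := norm_add_le _ _
    _ ≤ C * (1 + s) ^ n + D * (1 + s) ^ m := add_le_add (hf s hs) (hg s hs)
    _ ≤ C * (1 + s) ^ (n + m) + D * (1 + s) ^ (n + m) := by gcongr
    _ = _ := by ring

theorem PolyBounded.pow {f : ℝ → ℂ} (hf : PolyBounded f) (k : ℕ) :
    PolyBounded fun s => f s ^ k := by
  induction k with
  | zero => simpa using PolyBounded.const 1
  | succ k ih => simpa only [pow_succ] using ih.mul hf

theorem integrableOn_one_add_pow_mul_exp {c : ℝ} (hc : 0 < c) (n : ℕ) :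
    IntegrableOn (fun u : ℝ => (1 + u) ^ n * Real.exp (-c * u ^ 2)) (Set.Ioi 0) := by
  have h1 := integrableOn_rpow_mul_exp_neg_mul_sq hc (s := 0) (by norm_num)
  have h2 := integrableOn_rpow_mul_exp_neg_mul_sq hc (s := n)
    (by linarith [Nat.cast_nonneg (α := ℝ) n])
  refine ((h1.add h2).const_mul (2 ^ (n - 1))).mono' ?_ ?_
  · exact Continuous.aestronglyMeasurable (by fun_prop)
  · filter_upwards [ae_restrict_mem measurableSet_Ioi] with u hu
    have hu : 0 < u := hu
    have := add_pow_le zero_le_one hu.le n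
    rw [Real.norm_of_nonneg (by positivity)]
    simp only [Pi.add_apply, Real.rpow_zero, Real.rpow_natCast]
    rw [one_pow] at this
    calc _ ≤ (2 ^ (n - 1) * (1 + u ^ n)) * Real.exp (-c * u ^ 2) := by gcongr
      _ = _ := by ring

section Laplace

variable {φ g : ℝ → ℂ} {c : ℝ}

theorem norm_cexp_mul_le (hφ : ∀ s, 0 < s → (φ s).re ≤ -c * s ^ 2) {lam s : ℝ} (hlam : 0 ≤ lam)
    (hs : 0 < s) : ‖Complex.exp (lam * φ s)‖ ≤ Real.exp (-(lam * c) * s ^ 2) := by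
  rw [Complex.norm_exp, Complex.re_ofReal_mul]
  refine Real.exp_le_exp.2 ?_
  have := mul_le_mul_of_nonneg_left (hφ s hs) hlam
  linarith

theorem integrableOn_laplace (hφc : Continuous φ) (hgc : Continuous g) (hc : 0 < c)
    (hφ : ∀ s, 0 < s → (φ s).re ≤ -c * s ^ 2) (hg : PolyBounded g) {lam : ℝ} (hlam : 0 < lam) :
    IntegrableOn (fun s => Complex.exp (lam * φ s) * g s) (Set.Ioi 0) := by
  obtain ⟨C, n, hC, hg⟩ := hg
  refine ((integrableOn_one_add_pow_mul_exp (mul_pos hlam hc) n).const_mul C).mono' ?_ ?_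
  · exact Continuous.aestronglyMeasurable (by fun_prop)
  · filter_upwards [ae_restrict_mem measurableSet_Ioi] with s hs
    rw [norm_mul]
    calc _ ≤ Real.exp (-(lam * c) * s ^ 2) * (C * (1 + s) ^ n) :=
          mul_le_mul (norm_cexp_mul_le hφ hlam.le hs) (hg s hs) (norm_nonneg _) (by positivity)
      _ = _ := by ring

/-- Laplace's method on a half line, with the maximum of the exponent at the end point. -/
theorem tendsto_laplace (hφc : Continuous φ) (hgc : Continuous g) (hc : 0 < c)
    (hφ : ∀ s, 0 < s → (φ s).re ≤ -c * s ^ 2) (hg : PolyBounded g) {a : ℂ}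
    (ha : Tendsto (fun s : ℝ => φ s / (s : ℂ) ^ 2) (𝓝[>] 0) (𝓝 (-a))) :
    Tendsto (fun lam : ℝ => (√lam : ℂ) * ∫ s in Set.Ioi (0 : ℝ), Complex.exp (lam * φ s) * g s)
      atTop (𝓝 (∫ u in Set.Ioi (0 : ℝ), Complex.exp (-a * (u : ℂ) ^ 2) * g 0)) := by
  obtain ⟨C, n, hC, hg⟩ := hg
  -- The substitution `s = u/√λ`, after which the Gaussian bound `exp(-c u²)` no longer depends on
  -- `λ`.
  have hscale : ∀ᶠ lam : ℝ in atTop,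
      ∫ u in Set.Ioi (0 : ℝ), Complex.exp (lam * φ ((√lam)⁻¹ * u)) * g ((√lam)⁻¹ * u) =
        (√lam : ℂ) * ∫ s in Set.Ioi (0 : ℝ), Complex.exp (lam * φ s) * g s := by
    filter_upwards [eventually_gt_atTop 0] with lam hlam
    have := integral_comp_mul_left_Ioi (fun s => Complex.exp (lam * φ s) * g s) 0
      (inv_pos.2 (Real.sqrt_pos.2 hlam))
    rw [this, mul_zero, inv_inv, Complex.real_smul]
  refine Tendsto.congr' hscale ?_
  refine tendsto_integral_filter_of_dominated_convergence
    (fun u => C * ((1 + u) ^ n * Real.exp (-c * u ^ 2))) (Eventually.of_forall fun lam => ?_) ?_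
    ((integrableOn_one_add_pow_mul_exp hc n).const_mul C) ?_
  · exact Continuous.aestronglyMeasurable (by fun_prop)
  · filter_upwards [eventually_ge_atTop 1] with lam hlam
    filter_upwards [ae_restrict_mem measurableSet_Ioi] with u hu
    have hu : 0 < u := hu
    have hs1 : 1 ≤ √lam := Real.one_le_sqrt.2 hlam
    have hs0 : 0 < √lam := by linarith
    have hv : 0 < (√lam)⁻¹ * u := by positivity
    have hvu : (√lam)⁻¹ * u ≤ u := mul_le_of_le_one_left hu.le (inv_le_one_of_one_le₀ hs1)
    have h1 := norm_cexp_mul_le hφ (lam := lam) (by linarith) hv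
    have h2 : -(lam * c) * ((√lam)⁻¹ * u) ^ 2 = -c * u ^ 2 := by
      have := Real.sq_sqrt (show (0 : ℝ) ≤ lam by linarith)
      rw [mul_pow, inv_pow, this]
      field_simp
    rw [h2] at h1
    rw [norm_mul]
    calc _ ≤ Real.exp (-c * u ^ 2) * (C * (1 + (√lam)⁻¹ * u) ^ n) :=
          mul_le_mul h1 (hg _ hv) (norm_nonneg _) (by positivity)
      _ ≤ Real.exp (-c * u ^ 2) * (C * (1 + u) ^ n) := by gcongr
      _ = _ := by ring
  · filter_upwards [ae_restrict_mem measurableSet_Ioi] with u hu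
    have hu : 0 < u := hu
    have hzero : Tendsto (fun lam : ℝ => (√lam)⁻¹ * u) atTop (𝓝 0) := by
      have := (tendsto_inv_atTop_zero.comp Real.tendsto_sqrt_atTop).mul_const u
      simpa using this
    have hv : Tendsto (fun lam : ℝ => (√lam)⁻¹ * u) atTop (𝓝[>] 0) := by
      refine tendsto_nhdsWithin_iff.2 ⟨hzero, ?_⟩
      filter_upwards [eventually_gt_atTop 0] with lam hlam
      have := Real.sqrt_pos.2 hlam
      exact mul_pos (inv_pos.2 this) hu
    refine Tendsto.mul ?_ ((hgc.tendsto 0).comp hzero)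
    refine (Complex.continuous_exp.tendsto _).comp ?_
    refine ((ha.comp hv).mul_const ((u : ℂ) ^ 2)).congr' ?_
    filter_upwards [eventually_gt_atTop 0] with lam hlam
    have hs := Real.sqrt_pos.2 hlam
    have hsC : (√lam : ℂ) ≠ 0 := Complex.ofReal_ne_zero.2 hs.ne'
    have huC : (u : ℂ) ≠ 0 := Complex.ofReal_ne_zero.2 hu.ne'
    have h2 : (lam : ℂ) = (√lam : ℂ) ^ 2 := by
      rw [← Complex.ofReal_pow, Real.sq_sqrt hlam.le]
    simp only [Function.comp_apply]
    rw [h2]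
    push_cast
    field_simp

/-- Differentiation brings down a factor `φ`, which keeps polynomial growth. For parameters above
`λ/2` a single Gaussian dominates. -/
theorem hasDerivAt_laplace (hφc : Continuous φ) (hgc : Continuous g) (hc : 0 < c)
    (hφ : ∀ s, 0 < s → (φ s).re ≤ -c * s ^ 2) (hg : PolyBounded g) (hφg : PolyBounded φ)
    {lam : ℝ} (hlam : 0 < lam) :
    HasDerivAt (fun lam : ℝ => ∫ s in Set.Ioi (0 : ℝ), Complex.exp (lam * φ s) * g s)
      (∫ s in Set.Ioi (0 : ℝ), Complex.exp (lam * φ s) * (φ s * g s)) lam := by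
  obtain ⟨C, n, hC, hb⟩ := hφg.mul hg
  have hmem : Set.Ioi (lam / 2) ∈ 𝓝 lam := Ioi_mem_nhds (by linarith)
  refine (hasDerivAt_integral_of_dominated_loc_of_deriv_le (μ := volume.restrict (Set.Ioi 0))
    (F := fun (x : ℝ) s => Complex.exp (x * φ s) * g s)
    (bound := fun s => C * ((1 + s) ^ n * Real.exp (-(lam / 2 * c) * s ^ 2)))
    (F' := fun (x : ℝ) s => Complex.exp (x * φ s) * (φ s * g s)) hmem
    (Eventually.of_forall fun x => ?_) (integrableOn_laplace hφc hgc hc hφ hg hlam) ?_ ?_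
    ((integrableOn_one_add_pow_mul_exp (mul_pos (half_pos hlam) hc) n).const_mul C) ?_).2
  · exact Continuous.aestronglyMeasurable (by fun_prop)
  · exact Continuous.aestronglyMeasurable (by fun_prop)
  · filter_upwards [ae_restrict_mem measurableSet_Ioi] with s hs x hx
    have hs : 0 < s := hs
    have hx : lam / 2 < x := hx
    rw [norm_mul]
    calc _ ≤ Real.exp (-(x * c) * s ^ 2) * (C * (1 + s) ^ n) :=
          mul_le_mul (norm_cexp_mul_le hφ (by linarith) hs) (hb s hs) (norm_nonneg _)
            (by positivity)
      _ ≤ Real.exp (-(lam / 2 * c) * s ^ 2) * (C * (1 + s) ^ n) := by gcongr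
      _ = _ := by ring
  · refine Eventually.of_forall fun s x _ => ?_
    have h1 : HasDerivAt (fun x : ℝ => (x : ℂ) * φ s) (φ s) x := by
      simpa using (hasDerivAt_id x).ofReal_comp.mul_const (φ s)
    refine (h1.cexp.mul_const (g s)).congr_deriv ?_
    ring

end Laplace

/-! ### Half parabolas of descent -/

/-- The exponent along the half parabola `t₀ + a₁ s + a₂ s²`, relative to its start. -/
noncomputable def halfPhase (t₀ a₁ a₂ : ℂ) (s : ℝ) : ℂ :=
  Complex.I * (fMinus (t₀ + a₁ * s + a₂ * s ^ 2) - fMinus t₀)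

/-- A half parabola of descent that starts at the saddle `t₀`. -/
structure IsHalfPath (t₀ a₁ a₂ : ℂ) (c : ℝ) : Prop where
  saddle : t₀ ^ 4 = 1
  pos : 0 < c
  descent : ∀ s : ℝ, 0 < s → (halfPhase t₀ a₁ a₂ s).re ≤ -c * s ^ 2

/-- The contribution of a half parabola to the saddle integral, without the exponential factor. -/
noncomputable def halfIntegral (t₀ a₁ a₂ : ℂ) (lam : ℝ) : ℂ :=
  ∫ s in Set.Ioi (0 : ℝ), Complex.exp (lam * halfPhase t₀ a₁ a₂ s) * (a₁ + 2 * a₂ * s)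

section HalfPath

variable {t₀ a₁ a₂ : ℂ} {c : ℝ}

/-- The Taylor expansion of `f₋` at `t₀` with increment `s(a₁ + a₂s)`. The saddle condition removes
the linear term. -/
theorem halfPhase_eq (ht : t₀ ^ 4 = 1) (s : ℝ) :
    halfPhase t₀ a₁ a₂ s = (s : ℂ) ^ 2 * (Complex.I * (a₁ + a₂ * s) ^ 2 *
      (2 * t₀ ^ 3 + 2 * t₀ ^ 2 * (s * (a₁ + a₂ * s)) + t₀ * (s * (a₁ + a₂ * s)) ^ 2 +
        (s * (a₁ + a₂ * s)) ^ 3 / 5)) := by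
  unfold halfPhase fMinus
  linear_combination (Complex.I * (s * (a₁ + a₂ * s))) * ht

theorem continuous_halfPhase : Continuous (halfPhase t₀ a₁ a₂) := by
  have := continuous_fMinus
  unfold halfPhase
  fun_prop

theorem polyBounded_halfPhase (ht : t₀ ^ 4 = 1) : PolyBounded (halfPhase t₀ a₁ a₂) := by
  have h1 : PolyBounded fun s : ℝ => a₁ + a₂ * s :=
    (PolyBounded.const a₁).add ((PolyBounded.const a₂).mul .ofReal)
  have h2 := PolyBounded.ofReal.mul h1
  have h3 := (PolyBounded.ofReal.pow 2).mul (((PolyBounded.const Complex.I).mul (h1.pow 2)).mul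
    ((((PolyBounded.const (2 * t₀ ^ 3)).add ((PolyBounded.const (2 * t₀ ^ 2)).mul h2)).add
      ((PolyBounded.const t₀).mul (h2.pow 2))).add ((h2.pow 3).mul (.const (5⁻¹ : ℂ)))))
  simpa only [← div_eq_mul_inv, ← halfPhase_eq ht] using h3

theorem polyBounded_velocity : PolyBounded fun s : ℝ => a₁ + 2 * a₂ * s :=
  (PolyBounded.const a₁).add ((PolyBounded.const (2 * a₂)).mul .ofReal)

theorem tendsto_halfPhase_div (ht : t₀ ^ 4 = 1) :
    Tendsto (fun s : ℝ => halfPhase t₀ a₁ a₂ s / (s : ℂ) ^ 2) (𝓝[>] 0)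
      (𝓝 (-(-2 * Complex.I * t₀ ^ 3 * a₁ ^ 2))) := by
  have hc : Continuous fun s : ℝ => Complex.I * (a₁ + a₂ * s) ^ 2 *
      (2 * t₀ ^ 3 + 2 * t₀ ^ 2 * (s * (a₁ + a₂ * s)) + t₀ * (s * (a₁ + a₂ * s)) ^ 2 +
        (s * (a₁ + a₂ * s)) ^ 3 / 5) := by fun_prop
  have h := (hc.tendsto 0).mono_left (nhdsWithin_le_nhds (s := Set.Ioi 0))
  have h0 : Complex.I * (a₁ + a₂ * (0 : ℝ)) ^ 2 *
      (2 * t₀ ^ 3 + 2 * t₀ ^ 2 * ((0 : ℝ) * (a₁ + a₂ * (0 : ℝ))) +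
        t₀ * ((0 : ℝ) * (a₁ + a₂ * (0 : ℝ))) ^ 2 + ((0 : ℝ) * (a₁ + a₂ * (0 : ℝ))) ^ 3 / 5) =
      -(-2 * Complex.I * t₀ ^ 3 * a₁ ^ 2) := by
    push_cast
    ring
  rw [h0] at h
  refine h.congr' ?_
  filter_upwards [self_mem_nhdsWithin] with s hs
  have hs : (s : ℂ) ≠ 0 := Complex.ofReal_ne_zero.2 (ne_of_gt hs)
  rw [halfPhase_eq ht, mul_div_cancel_left₀ _ (pow_ne_zero 2 hs)]

theorem IsHalfPath.re_pos (h : IsHalfPath t₀ a₁ a₂ c) :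
    0 < (-2 * Complex.I * t₀ ^ 3 * a₁ ^ 2).re := by
  have h1 := (Complex.continuous_re.tendsto _).comp
    (tendsto_halfPhase_div (a₁ := a₁) (a₂ := a₂) h.saddle)
  have h2 : (-(-2 * Complex.I * t₀ ^ 3 * a₁ ^ 2)).re ≤ -c := by
    refine le_of_tendsto h1 ?_
    filter_upwards [self_mem_nhdsWithin] with s hs
    have hs : 0 < s := hs
    simp only [Function.comp_apply]
    rw [← Complex.ofReal_pow, Complex.div_ofReal_re, div_le_iff₀ (by positivity)]
    exact h.descent s hs
  rw [Complex.neg_re] at h2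
  linarith [h.pos]

/-- The limit is half of a Gaussian integral with coefficient `A = -2i t₀³ a₁²`. The number `W` is
the square root of `π/A` with positive real part, so the branch is fixed without computing
arguments. -/
theorem IsHalfPath.tendsto (h : IsHalfPath t₀ a₁ a₂ c) {W : ℂ} (hW : 0 < W.re)
    (hW2 : W ^ 2 * (-2 * Complex.I * t₀ ^ 3 * a₁ ^ 2) = Real.pi) :
    Tendsto (fun lam : ℝ => (√lam : ℂ) * halfIntegral t₀ a₁ a₂ lam) atTop (𝓝 (a₁ * W / 2)) := by
  have h1 := tendsto_laplace continuous_halfPhase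
    (g := fun s : ℝ => a₁ + 2 * a₂ * s) (by fun_prop) h.pos h.descent polyBounded_velocity
    (tendsto_halfPhase_div h.saddle)
  have hne : (-2 * Complex.I * t₀ ^ 3 * a₁ ^ 2) ≠ 0 := by
    intro h0
    have := h.re_pos
    rw [h0] at this
    simp at this
  have he : ∫ u in Set.Ioi (0 : ℝ), Complex.exp (-(-2 * Complex.I * t₀ ^ 3 * a₁ ^ 2) *
      (u : ℂ) ^ 2) * (a₁ + 2 * a₂ * (0 : ℝ)) = a₁ * W / 2 := by
    rw [integral_mul_const, integral_gaussian_complex_Ioi h.re_pos, ← hW2,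
      mul_div_cancel_right₀ _ hne, one_div, Complex.sq_cpow_two_inv hW]
    push_cast
    ring
  rw [← he]
  exact h1

/-- The derivative has two terms. One is the convergent quantity divided by `2λ`. The other is again
a Laplace integral, with amplitude vanishing at `s = 0`, so its rescaled limit is zero. -/
theorem IsHalfPath.exists_deriv (h : IsHalfPath t₀ a₁ a₂ c) {W : ℂ} (hW : 0 < W.re)
    (hW2 : W ^ 2 * (-2 * Complex.I * t₀ ^ 3 * a₁ ^ 2) = Real.pi) :
    ∃ D : ℝ → ℂ, Tendsto D atTop (𝓝 0) ∧
      ∀ lam : ℝ, 0 < lam →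
        HasDerivAt (fun lam : ℝ => (√lam : ℂ) * halfIntegral t₀ a₁ a₂ lam) (D lam) lam := by
  set H₁ : ℝ → ℂ := fun lam => ∫ s in Set.Ioi (0 : ℝ), Complex.exp (lam * halfPhase t₀ a₁ a₂ s) *
    (halfPhase t₀ a₁ a₂ s * (a₁ + 2 * a₂ * s)) with hH₁
  have hT : Tendsto (fun lam : ℝ => (√lam : ℂ) * H₁ lam) atTop (𝓝 0) := by
    have hpc := continuous_halfPhase (t₀ := t₀) (a₁ := a₁) (a₂ := a₂)
    have h1 := tendsto_laplace continuous_halfPhase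
      (g := fun s : ℝ => halfPhase t₀ a₁ a₂ s * (a₁ + 2 * a₂ * s)) (by fun_prop) h.pos h.descent
      ((polyBounded_halfPhase h.saddle).mul polyBounded_velocity) (tendsto_halfPhase_div h.saddle)
    have h0 : halfPhase t₀ a₁ a₂ 0 = 0 := by simp [halfPhase]
    simpa [h0] using h1
  have hS : Tendsto (fun lam : ℝ => (((2 * lam)⁻¹ : ℝ) : ℂ) *
      ((√lam : ℂ) * halfIntegral t₀ a₁ a₂ lam)) atTop (𝓝 0) := by
    have h1 : Tendsto (fun lam : ℝ => (2 * lam)⁻¹) atTop (𝓝 0) :=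
      tendsto_inv_atTop_zero.comp (tendsto_id.const_mul_atTop two_pos)
    have h2 := (Complex.continuous_ofReal.tendsto 0).comp h1
    simpa using h2.mul (h.tendsto hW hW2)
  refine ⟨_, by simpa using hS.add hT, fun lam hlam => ?_⟩
  have h1 := (Real.hasDerivAt_sqrt hlam.ne').ofReal_comp
  have h2 := hasDerivAt_laplace continuous_halfPhase
    (g := fun s : ℝ => a₁ + 2 * a₂ * s) (by fun_prop) h.pos h.descent polyBounded_velocity
    (polyBounded_halfPhase h.saddle) hlam
  refine (h1.mul h2).congr_deriv ?_
  have hs := Real.sqrt_pos.2 hlam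
  have hsC : (√lam : ℂ) ≠ 0 := Complex.ofReal_ne_zero.2 hs.ne'
  have hl : (lam : ℂ) = (√lam : ℂ) ^ 2 := by rw [← Complex.ofReal_pow, Real.sq_sqrt hlam.le]
  simp only [hH₁, halfIntegral]
  congr 1
  rw [← mul_assoc]
  congr 1
  push_cast
  conv_rhs => rw [hl]
  field_simp

theorem IsHalfPath.primitive_limit (h : IsHalfPath t₀ a₁ a₂ c) {lam : ℝ} (hlam : 0 < lam)
    {F : ℂ → ℂ} (hF : IsPhasePrimitive lam F) {V : ℂ}
    (hV : Tendsto (fun s : ℝ => F (t₀ + a₁ * s + a₂ * s ^ 2)) atTop (𝓝 V)) :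
    V - F t₀ = Complex.exp (Complex.I * lam * fMinus t₀) * halfIntegral t₀ a₁ a₂ lam := by
  have hint := (integrableOn_laplace continuous_halfPhase
    (g := fun s : ℝ => a₁ + 2 * a₂ * s) (by fun_prop) h.pos h.descent polyBounded_velocity
    hlam).const_mul (Complex.exp (Complex.I * lam * fMinus t₀))
  have := integral_Ioi_of_hasDerivAt_of_tendsto' (a := 0) (fun s _ => ?_) hint hV
  · rw [halfIntegral, ← integral_const_mul, this]
    simp
  · have h1 : HasDerivAt (fun s : ℝ => t₀ + a₁ * s + a₂ * s ^ 2) (a₁ + 2 * a₂ * s) s := by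
      have h2 : HasDerivAt (fun s : ℝ => (s : ℂ)) 1 s := (hasDerivAt_id s).ofReal_comp
      refine (((h2.const_mul a₁).const_add t₀).add ((h2.pow 2).const_mul a₂)).congr_deriv ?_
      push_cast
      ring
    refine ((hF.hasDerivAt _).comp s h1).congr_deriv ?_
    rw [← mul_assoc, ← Complex.exp_add]
    congr 2
    unfold halfPhase
    ring

end HalfPath

/-! ### The explicit half paths from `1` and `-i` -/

/-- The direction of the right valley. -/
noncomputable def rightDir : ℂ := Complex.exp ((Real.pi / 10 : ℝ) * Complex.I)

/-- The slope `cot (3π/10)` of the lower valley. -/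
noncomputable def lowerSlope : ℝ := Real.cos (3 * Real.pi / 10) / Real.sin (3 * Real.pi / 10)

/-- A vector in the direction of the lower valley. -/
noncomputable def lowerDir : ℂ := lowerSlope - Complex.I

theorem lowerSlope_bounds : 0.725 < lowerSlope ∧ lowerSlope < 0.728 := by
  obtain ⟨h5, h6⟩ := sin_three_pi_div_ten_bounds
  obtain ⟨h7, h8⟩ := cos_three_pi_div_ten_bounds
  unfold lowerSlope
  rw [lt_div_iff₀ (by linarith), div_lt_iff₀ (by linarith)]
  constructor <;> linarith

theorem lowerDir_direction : lowerDir / (‖lowerDir‖ : ℂ) =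
    Complex.exp ((17 * Real.pi / 10 : ℝ) * Complex.I) := by
  set S := Real.sin (3 * Real.pi / 10) with hS
  obtain ⟨h5, -⟩ := sin_three_pi_div_ten_bounds
  have hS0 : 0 < S := by linarith
  have he : lowerDir = ((S⁻¹ : ℝ) : ℂ) * Complex.exp ((17 * Real.pi / 10 : ℝ) * Complex.I) := by
    obtain ⟨h1, h2⟩ := exp_mul_I_re_im (17 * Real.pi / 10)
    obtain ⟨h3, h4⟩ := cos_sin_seventeen_pi_div_ten
    apply Complex.ext
    · rw [Complex.re_ofReal_mul, h1, h3]
      simp only [lowerDir, Complex.sub_re, Complex.ofReal_re, Complex.I_re, sub_zero, lowerSlope,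
        div_eq_inv_mul, hS]
    · rw [Complex.im_ofReal_mul, h2, h4, ← hS, mul_neg, inv_mul_cancel₀ hS0.ne']
      simp [lowerDir]
  have hn : ‖lowerDir‖ = S⁻¹ := by
    rw [he, norm_mul, Complex.norm_exp_ofReal_mul_I, mul_one, Complex.norm_real,
      Real.norm_of_nonneg (inv_nonneg.2 hS0.le)]
  rw [hn, he, mul_div_cancel_left₀]
  exact Complex.ofReal_ne_zero.2 (inv_ne_zero hS0.ne')

theorem halfPhase_re (t₀ a₁ a₂ : ℂ) (s : ℝ) : (halfPhase t₀ a₁ a₂ s).re =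
    (fMinus t₀).im - (fMinus (t₀ + a₁ * s + a₂ * s ^ 2)).im := by
  simp [halfPhase, Complex.mul_re]

theorem re_im_half_path (t₀ a₁ a₂ : ℂ) (s : ℝ) :
    (t₀ + a₁ * s + a₂ * s ^ 2).re = t₀.re + a₁.re * s + a₂.re * s ^ 2 ∧
      (t₀ + a₁ * s + a₂ * s ^ 2).im = t₀.im + a₁.im * s + a₂.im * s ^ 2 := by
  rw [← Complex.ofReal_pow]
  simp only [Complex.add_re, Complex.add_im, Complex.re_mul_ofReal, Complex.im_mul_ofReal,
    and_self]

/-- On this ray `x² ≥ 1` and `x² - 2y² ≥ 1 + s`, so the second factor of `Im f₋` is at least `s`,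
while the first is `s sin(π/10)`. -/
theorem isHalfPath_right : IsHalfPath 1 rightDir 0 (Real.sin (Real.pi / 10)) := by
  obtain ⟨h1, h2⟩ := exp_mul_I_re_im (Real.pi / 10)
  obtain ⟨h3, h4⟩ := sin_pi_div_ten_bounds
  have h5 := cos_pi_div_ten_gt
  refine ⟨by norm_num, h3, fun s hs => ?_⟩
  obtain ⟨h6, h7⟩ := re_im_half_path 1 rightDir 0 s
  rw [halfPhase_re, fMinus_im, fMinus_im, h6, h7]
  simp only [rightDir, h1, h2, Complex.one_re, Complex.one_im, Complex.zero_re, Complex.zero_im,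
    zero_mul, add_zero, zero_add]
  set c := Real.cos (Real.pi / 10)
  set σ := Real.sin (Real.pi / 10)
  have hx : 1 ≤ (1 + c * s) ^ 2 := by nlinarith [mul_pos (show 0 < c by linarith) hs]
  have hy : 1 + s ≤ (1 + c * s) ^ 2 - 2 * (σ * s) ^ 2 := by
    have h8 : 2 * σ ^ 2 ≤ c ^ 2 := by nlinarith
    nlinarith [mul_le_mul_of_nonneg_right h8 (sq_nonneg s)]
  have hE : s ≤ (1 + c * s) ^ 4 - 2 * (1 + c * s) ^ 2 * (σ * s) ^ 2 + (σ * s) ^ 4 / 5 - 1 := by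
    have h9 : 0 ≤ (σ * s) ^ 4 / 5 := by positivity
    nlinarith [mul_le_mul hx hy (by linarith) (sq_nonneg _)]
  nlinarith [mul_le_mul_of_nonneg_left hE (mul_pos h3 hs).le]

/-- A straight ray into the lower valley would start uphill: at `1` descent requires `Im h² > 0`,
which fails for `h = lowerDir`. The path therefore leaves with the tangent `-1/4 - i`, for which `Im
h² = 1/2`, and bends into the valley through its quadratic term. -/
theorem isHalfPath_lower_one : IsHalfPath 1 (-1 / 4 - Complex.I) lowerDir (1 / 2) := by
  obtain ⟨hp1, hp2⟩ := lowerSlope_bounds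
  refine ⟨by norm_num, by norm_num, fun s hs => ?_⟩
  obtain ⟨h6, h7⟩ := re_im_half_path 1 (-1 / 4 - Complex.I) lowerDir s
  have h8 : (-1 / 4 - Complex.I : ℂ).re = -1 / 4 := by simp
  have h9 : (-1 / 4 - Complex.I : ℂ).im = -1 := by simp
  have h10 : lowerDir.re = lowerSlope := by simp [lowerDir]
  have h11 : lowerDir.im = -1 := by simp [lowerDir]
  rw [halfPhase_re, fMinus_im, fMinus_im, h6, h7, h8, h9, h10, h11]
  simp only [Complex.one_re, Complex.one_im, zero_mul, zero_add]
  set p := lowerSlope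
  have hq1 : 0.525 < p ^ 2 := by nlinarith
  have hq2 : p ^ 2 < 0.53 := by nlinarith
  have hr1 : 0.38 < p ^ 3 := by nlinarith
  have hr2 : p ^ 3 < 0.39 := by nlinarith
  have hu2 : p ^ 4 < 0.29 := by nlinarith
  -- These are the coefficients of `s⁵` to `s¹⁰` in `Im f₋` along the path, each nonnegative by the
  -- bounds on `p`.
  have k5 : 0 ≤ 3819 / 1280 + 25 / 4 * p - 6 * p ^ 2 := by linarith
  have k6 : 0 ≤ -417 / 256 + 165 / 16 * p - 3 * p ^ 2 := by linarith
  have k7 : 0 ≤ -21 / 8 + 145 / 16 * p + 37 / 8 * p ^ 2 - 4 * p ^ 3 := by linarith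
  have k8 : 0 ≤ -15 / 8 + p + 45 / 8 * p ^ 2 - 3 * p ^ 3 := by linarith
  have k9 : 0 ≤ -1 - p + 6 * p ^ 2 + p ^ 3 - p ^ 4 := by linarith
  have k10 : 0 ≤ -1 / 5 + 2 * p ^ 2 - p ^ 4 := by linarith
  -- The `s³` coefficient is negative, so it is absorbed by the `s²` term left after subtracting
  -- `s²/2` and by the `s⁴` term.
  have k3 : 0 ≤ 1 / 2 + (21 / 8 - 4 * p) * s + (75 / 16 - p) * s ^ 2 := by
    nlinarith [sq_nonneg (s - 1 / 20)]
  have m3 := mul_nonneg k3 (by positivity : 0 ≤ s ^ 2)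
  have m5 := mul_nonneg k5 (by positivity : 0 ≤ s ^ 5)
  have m6 := mul_nonneg k6 (by positivity : 0 ≤ s ^ 6)
  have m7 := mul_nonneg k7 (by positivity : 0 ≤ s ^ 7)
  have m8 := mul_nonneg k8 (by positivity : 0 ≤ s ^ 8)
  have m9 := mul_nonneg k9 (by positivity : 0 ≤ s ^ 9)
  have m10 := mul_nonneg k10 (by positivity : 0 ≤ s ^ 10)
  linarith

/-- The tangent `1` is the steepest descent direction at `-i`, with leading exponent `-2s²`. All
higher coefficients have the favourable sign, so nothing is lost in `c = 2`. -/
theorem isHalfPath_lower_neg_I : IsHalfPath (-Complex.I) 1 lowerDir 2 := by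
  obtain ⟨hp1, hp2⟩ := lowerSlope_bounds
  refine ⟨by rw [neg_pow, Complex.I_pow_four]; norm_num, by norm_num, fun s hs => ?_⟩
  obtain ⟨h6, h7⟩ := re_im_half_path (-Complex.I) 1 lowerDir s
  have h10 : lowerDir.re = lowerSlope := by simp [lowerDir]
  have h11 : lowerDir.im = -1 := by simp [lowerDir]
  rw [halfPhase_re, fMinus_im, fMinus_im, h6, h7, h10, h11]
  simp only [Complex.one_re, Complex.one_im, Complex.neg_re, Complex.neg_im, Complex.I_re,
    Complex.I_im]
  set p := lowerSlope
  have hp0 : 0 < p := by linarith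
  have hq1 : 0.525 < p ^ 2 := by nlinarith
  have hq2 : p ^ 2 < 0.53 := by nlinarith
  have hr2 : p ^ 3 ≤ p := by nlinarith
  have hu2 : p ^ 4 < 0.29 := by nlinarith
  have k7 : 0 ≤ 8 * p - 4 * p ^ 3 := by linarith
  have k8 : 0 ≤ 1 - p ^ 4 := by linarith
  have k9 : 0 ≤ 4 * p - 4 * p ^ 3 := by linarith
  have k10 : 0 ≤ -1 / 5 + 2 * p ^ 2 - p ^ 4 := by linarith
  have m3 : 0 ≤ 4 * p * s ^ 3 := by positivity
  have m4 : 0 ≤ (3 + 2 * p ^ 2) * s ^ 4 := by positivity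
  have m5 : 0 ≤ 8 * p * s ^ 5 := by positivity
  have m6 : 0 ≤ 3 * s ^ 6 := by positivity
  have m7 := mul_nonneg k7 (by positivity : 0 ≤ s ^ 7)
  have m8 := mul_nonneg k8 (by positivity : 0 ≤ s ^ 8)
  have m9 := mul_nonneg k9 (by positivity : 0 ≤ s ^ 9)
  have m10 := mul_nonneg k10 (by positivity : 0 ≤ s ^ 10)
  linarith

/-! ### Contours glued from two half parabolas -/

section Geometry

variable {t₀ a₁ a₂ b₁ b₂ : ℂ}

theorem tendsto_ofReal_inv_atTop_zero :
    Tendsto (fun s : ℝ => ((s⁻¹ : ℝ) : ℂ)) atTop (𝓝 0) :=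
  (Complex.continuous_ofReal.tendsto' 0 0 Complex.ofReal_zero).comp tendsto_inv_atTop_zero

theorem tendsto_half_path_div (t₀ a₁ a₂ : ℂ) :
    Tendsto (fun s : ℝ => (t₀ + a₁ * s + a₂ * s ^ 2) / ((s ^ 2 : ℝ) : ℂ)) atTop (𝓝 a₂) := by
  have h1 := tendsto_ofReal_inv_atTop_zero
  have h2 := (((h1.pow 2).const_mul t₀).add (h1.const_mul a₁)).add_const a₂
  rw [zero_pow two_ne_zero, mul_zero, mul_zero, zero_add, zero_add] at h2
  refine h2.congr' ?_
  filter_upwards [eventually_gt_atTop 0] with s hs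
  have hs : (s : ℂ) ≠ 0 := Complex.ofReal_ne_zero.2 (ne_of_gt hs)
  push_cast
  field_simp

theorem norm_direction_of_tendsto_div {γ : ℝ → ℂ} {ρ : ℝ → ℝ} {l : Filter ℝ} {a : ℂ} (ha : a ≠ 0)
    (hρ : Tendsto ρ l atTop) (h : Tendsto (fun s => γ s / (ρ s : ℂ)) l (𝓝 a)) :
    Tendsto (fun s => ‖γ s‖) l atTop ∧
      Tendsto (fun s => γ s / (‖γ s‖ : ℂ)) l (𝓝 (a / (‖a‖ : ℂ))) := by
  have hn := h.norm
  have hpos := hρ.eventually_gt_atTop 0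
  constructor
  · refine (hn.pos_mul_atTop (norm_pos_iff.2 ha) hρ).congr' ?_
    filter_upwards [hpos] with s hs
    rw [norm_div, Complex.norm_real, Real.norm_of_nonneg hs.le, div_mul_cancel₀ _ hs.ne']
  · have h2 := h.div ((Complex.continuous_ofReal.tendsto _).comp hn)
      (Complex.ofReal_ne_zero.2 (norm_ne_zero_iff.2 ha))
    refine h2.congr' ?_
    filter_upwards [hpos] with s hs
    have hs' : (ρ s : ℂ) ≠ 0 := Complex.ofReal_ne_zero.2 hs.ne'
    simp only [Pi.div_apply, Function.comp_apply]
    rw [norm_div, Complex.norm_real, Real.norm_of_nonneg hs.le, Complex.ofReal_div,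
      div_div_div_cancel_right₀ hs']

/-- Two half parabolas glued at their common start. -/
noncomputable def gluedPath (t₀ b₁ b₂ a₁ a₂ : ℂ) (s : ℝ) : ℂ :=
  if 0 ≤ s then t₀ + a₁ * s + a₂ * s ^ 2 else t₀ + b₁ * (-s) + b₂ * s ^ 2

theorem gluedPath_pos {s : ℝ} (hs : 0 ≤ s) :
    gluedPath t₀ b₁ b₂ a₁ a₂ s = t₀ + a₁ * s + a₂ * s ^ 2 :=
  if_pos hs

theorem gluedPath_neg {s : ℝ} (hs : s < 0) :
    gluedPath t₀ b₁ b₂ a₁ a₂ s = t₀ + b₁ * (-s : ℝ) + b₂ * ((-s : ℝ) : ℂ) ^ 2 := by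
  rw [gluedPath, if_neg hs.not_ge]
  push_cast
  ring

theorem isContour_gluedPath {x y : ℝ}
    (hα : Tendsto (fun s => ‖gluedPath t₀ b₁ b₂ a₁ a₂ s‖) atBot atTop ∧
      Tendsto (fun s => gluedPath t₀ b₁ b₂ a₁ a₂ s / (‖gluedPath t₀ b₁ b₂ a₁ a₂ s‖ : ℂ)) atBot
        (𝓝 (Complex.exp (x * Complex.I))))
    (hβ : Tendsto (fun s => ‖gluedPath t₀ b₁ b₂ a₁ a₂ s‖) atTop atTop ∧
      Tendsto (fun s => gluedPath t₀ b₁ b₂ a₁ a₂ s / (‖gluedPath t₀ b₁ b₂ a₁ a₂ s‖ : ℂ)) atTop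
        (𝓝 (Complex.exp (y * Complex.I)))) :
    IsContour (gluedPath t₀ b₁ b₂ a₁ a₂) x y := by
  have hcR : ContDiff ℝ 1 fun s : ℝ => (s : ℂ) := Complex.ofRealCLM.contDiff
  have hp : ContDiff ℝ 1 fun s : ℝ => t₀ + a₁ * s + a₂ * s ^ 2 := by fun_prop
  have hq : ContDiff ℝ 1 fun s : ℝ => t₀ + b₁ * (-s) + b₂ * s ^ 2 := by fun_prop
  have hep : ∀ s : ℝ, 0 < s →
      gluedPath t₀ b₁ b₂ a₁ a₂ =ᶠ[𝓝 s] fun s : ℝ => t₀ + a₁ * s + a₂ * s ^ 2 := fun s hs => by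
    filter_upwards [lt_mem_nhds hs] with r hr using if_pos hr.le
  have heq : ∀ s : ℝ, s < 0 →
      gluedPath t₀ b₁ b₂ a₁ a₂ =ᶠ[𝓝 s] fun s : ℝ => t₀ + b₁ * (-s) + b₂ * s ^ 2 := fun s hs => by
    filter_upwards [gt_mem_nhds hs] with r hr using if_neg hr.not_ge
  refine ⟨?_, ⟨{0}, Set.finite_singleton 0, fun s hs => ?_⟩, ?_, hα.1, hβ.1, hα.2, hβ.2⟩
  · refine Continuous.if_le hp.continuous hq.continuous continuous_const continuous_id ?_
    rintro s rfl
    simp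
  · rcases lt_or_gt_of_ne (show s ≠ 0 from hs) with h | h
    · exact hq.contDiffAt.congr_of_eventuallyEq (heq s h)
    · exact hp.contDiffAt.congr_of_eventuallyEq (hep s h)
  -- Away from the gluing point the derivative is bounded by the sum of the speeds of the two smooth
  -- branches, which is continuous.
  · set g : ℝ → ℝ := fun s => ‖deriv (fun s : ℝ => t₀ + a₁ * s + a₂ * s ^ 2) s‖ +
      ‖deriv (fun s : ℝ => t₀ + b₁ * (-s) + b₂ * s ^ 2) s‖ with hg
    have hgc : Continuous g :=
      (hp.continuous_deriv le_rfl).norm.add (hq.continuous_deriv le_rfl).norm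
    refine hgc.locallyIntegrable.mono (measurable_deriv _).aestronglyMeasurable ?_
    have h0 : ∀ᵐ s : ℝ, s ≠ 0 := by simp [ae_iff]
    filter_upwards [h0] with s hs
    have hgn : ‖g s‖ = g s := Real.norm_of_nonneg (by positivity)
    rw [hgn]
    rcases lt_or_gt_of_ne hs with h | h
    · rw [(heq s h).deriv_eq]
      exact le_add_of_nonneg_left (norm_nonneg _)
    · rw [(hep s h).deriv_eq]
      exact le_add_of_nonneg_right (norm_nonneg _)

theorem gluedPath_atTop (ha : a₂ ≠ 0) :
    Tendsto (fun s => ‖gluedPath t₀ b₁ b₂ a₁ a₂ s‖) atTop atTop ∧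
      Tendsto (fun s => gluedPath t₀ b₁ b₂ a₁ a₂ s / (‖gluedPath t₀ b₁ b₂ a₁ a₂ s‖ : ℂ)) atTop
        (𝓝 (a₂ / (‖a₂‖ : ℂ))) := by
  refine norm_direction_of_tendsto_div (ρ := fun s => s ^ 2) ha (tendsto_pow_atTop two_ne_zero)
    ((tendsto_half_path_div t₀ a₁ a₂).congr' ?_)
  filter_upwards [eventually_ge_atTop 0] with s hs
  rw [gluedPath_pos hs]

theorem gluedPath_atTop_of_line (ha : a₁ ≠ 0) :
    Tendsto (fun s => ‖gluedPath t₀ b₁ b₂ a₁ 0 s‖) atTop atTop ∧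
      Tendsto (fun s => gluedPath t₀ b₁ b₂ a₁ 0 s / (‖gluedPath t₀ b₁ b₂ a₁ 0 s‖ : ℂ)) atTop
        (𝓝 (a₁ / (‖a₁‖ : ℂ))) := by
  refine norm_direction_of_tendsto_div (ρ := fun s => s) ha tendsto_id ?_
  have h1 := tendsto_ofReal_inv_atTop_zero
  have h2 := (h1.const_mul t₀).add_const a₁
  rw [mul_zero, zero_add] at h2
  refine h2.congr' ?_
  filter_upwards [eventually_gt_atTop 0] with s hs
  rw [gluedPath_pos hs.le]
  have hs : (s : ℂ) ≠ 0 := Complex.ofReal_ne_zero.2 (ne_of_gt hs)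
  push_cast
  field_simp
  ring

theorem gluedPath_atBot (hb : b₂ ≠ 0) :
    Tendsto (fun s => ‖gluedPath t₀ b₁ b₂ a₁ a₂ s‖) atBot atTop ∧
      Tendsto (fun s => gluedPath t₀ b₁ b₂ a₁ a₂ s / (‖gluedPath t₀ b₁ b₂ a₁ a₂ s‖ : ℂ)) atBot
        (𝓝 (b₂ / (‖b₂‖ : ℂ))) := by
  refine norm_direction_of_tendsto_div (ρ := fun s => (-s) ^ 2) hb
    ((tendsto_pow_atTop two_ne_zero).comp tendsto_neg_atBot_atTop)
    (((tendsto_half_path_div t₀ b₁ b₂).comp tendsto_neg_atBot_atTop).congr' ?_)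
  filter_upwards [eventually_lt_atBot 0] with s hs
  rw [gluedPath_neg hs]
  rfl

theorem gluedPath_descent {c d : ℝ} (ha : IsHalfPath t₀ a₁ a₂ c) (hb : IsHalfPath t₀ b₁ b₂ d)
    (s : ℝ) (hs : s ≠ 0) :
    (Complex.I * fMinus (gluedPath t₀ b₁ b₂ a₁ a₂ s)).re < (Complex.I * fMinus t₀).re := by
  rw [← sub_neg, ← Complex.sub_re, ← mul_sub]
  rcases lt_or_gt_of_ne hs with h | h
  · have hs' : 0 < -s := by linarith
    have h1 := hb.descent (-s) hs'
    rw [gluedPath_neg h]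
    have := mul_pos hb.pos (pow_pos hs' 2)
    unfold halfPhase at h1
    linarith
  · have h1 := ha.descent s h
    rw [gluedPath_pos h.le]
    have := mul_pos ha.pos (pow_pos h 2)
    unfold halfPhase at h1
    linarith

end Geometry

theorem lowerDir_ne_zero : lowerDir ≠ 0 := by
  intro h
  have := congrArg Complex.im h
  simp [lowerDir] at this

theorem exists_saddleContour_one :
    ∃ γ, IsSaddleContour γ 1 (17 * Real.pi / 10) (Real.pi / 10) := by
  have hE : rightDir / (‖rightDir‖ : ℂ) = Complex.exp ((Real.pi / 10 : ℝ) * Complex.I) := by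
    rw [rightDir, Complex.norm_exp_ofReal_mul_I, Complex.ofReal_one, div_one]
  refine ⟨gluedPath 1 (-1 / 4 - Complex.I) lowerDir rightDir 0, isContour_gluedPath ?_ ?_, ?_,
    gluedPath_descent isHalfPath_right isHalfPath_lower_one⟩
  · rw [← lowerDir_direction]
    exact gluedPath_atBot lowerDir_ne_zero
  · rw [← hE]
    exact gluedPath_atTop_of_line (Complex.exp_ne_zero _)
  · simp [gluedPath]

theorem IsHalfPath.neg_conj {t₀ a₁ a₂ : ℂ} {c : ℝ} (h : IsHalfPath t₀ a₁ a₂ c) :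
    IsHalfPath (-(starRingEnd ℂ) t₀) (-(starRingEnd ℂ) a₁) (-(starRingEnd ℂ) a₂) c := by
  refine ⟨?_, h.pos, fun s hs => ?_⟩
  · rw [neg_pow, ← map_pow, h.saddle]
    norm_num
  · have h1 := h.descent s hs
    rw [halfPhase_re] at h1 ⊢
    have h2 : -(starRingEnd ℂ) t₀ + -(starRingEnd ℂ) a₁ * s + -(starRingEnd ℂ) a₂ * s ^ 2 =
        -(starRingEnd ℂ) (t₀ + a₁ * s + a₂ * s ^ 2) := by
      simp only [map_add, map_mul, map_pow, Complex.conj_ofReal]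
      ring
    rw [h2, fMinus_neg_conj, fMinus_neg_conj]
    simpa using h1

theorem exists_saddleContour_neg_I :
    ∃ γ, IsSaddleContour γ (-Complex.I) (13 * Real.pi / 10) (17 * Real.pi / 10) := by
  have hb := isHalfPath_lower_neg_I.neg_conj
  have ht : -(starRingEnd ℂ) (-Complex.I) = -Complex.I := by simp
  rw [ht] at hb
  refine ⟨gluedPath (-Complex.I) (-(starRingEnd ℂ) 1) (-(starRingEnd ℂ) lowerDir) 1 lowerDir,
    isContour_gluedPath ?_ ?_, ?_, gluedPath_descent isHalfPath_lower_neg_I hb⟩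
  · have h2 : -(starRingEnd ℂ) lowerDir / (‖-(starRingEnd ℂ) lowerDir‖ : ℂ) =
        Complex.exp ((13 * Real.pi / 10 : ℝ) * Complex.I) := by
      rw [← neg_conj_exp_mul_I (x := 17 * Real.pi / 10)
        (by linarith [cos_sin_thirteen_pi_div_ten.1]) cos_sin_thirteen_pi_div_ten.2.symm,
        ← lowerDir_direction]
      simp [neg_div]
    rw [← h2]
    exact gluedPath_atBot (by simpa using lowerDir_ne_zero)
  · rw [← lowerDir_direction]
    exact gluedPath_atTop lowerDir_ne_zero
  · simp [gluedPath]

/-- The parameter is reversed along with the reflection, so the two ends are exchanged. This carries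
the contour through `1` to one through `-1` with the required orientation. -/
theorem IsContour.reflect {γ : ℝ → ℂ} {α β α' β' : ℝ} (h : IsContour γ α β)
    (hα : Real.cos α' = -Real.cos α) (hα' : Real.sin α' = Real.sin α)
    (hβ : Real.cos β' = -Real.cos β) (hβ' : Real.sin β' = Real.sin β) :
    IsContour (fun s => -(starRingEnd ℂ) (γ (-s))) β' α' := by
  set L : ℂ →L[ℝ] ℂ := -(Complex.conjCLE : ℂ →L[ℝ] ℂ) with hL
  have hfun : (fun s => -(starRingEnd ℂ) (γ (-s))) = fun s => L (γ (-s)) := by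
    funext s
    simp [hL]
  obtain ⟨S, hS, hsm⟩ := h.piecewise_smooth
  refine ⟨?_, ⟨Neg.neg ⁻¹' S, hS.preimage neg_injective.injOn, fun s hs => ?_⟩, ?_, ?_, ?_, ?_, ?_⟩
  · have := h.continuous
    fun_prop
  · rw [hfun]
    exact L.contDiff.contDiffAt.comp s ((hsm (-s) hs).comp s contDiff_neg.contDiffAt)
  · have hd : LocallyIntegrable (fun s => deriv γ (-s)) volume := by
      intro s
      obtain ⟨U, hU, hi⟩ := h.locally_rectifiable (-s)
      refine ⟨Neg.neg ⁻¹' U, continuous_neg.continuousAt.preimage_mem_nhds hU, ?_⟩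
      exact ((Measure.measurePreserving_neg volume).integrableOn_comp_preimage
        (Homeomorph.neg ℝ).measurableEmbedding).2 hi
    refine hd.mono (measurable_deriv _).aestronglyMeasurable ?_
    have h0 : ∀ᵐ s : ℝ, s ∉ Neg.neg ⁻¹' S :=
      compl_mem_ae_iff.2 ((hS.preimage neg_injective.injOn).measure_zero _)
    filter_upwards [h0] with s hs
    have h1 := ((hsm (-s) hs).differentiableAt one_ne_zero).hasDerivAt.scomp s (hasDerivAt_neg s)
    have h2 := L.hasFDerivAt.comp_hasDerivAt s h1
    rw [hfun]
    have h3 : deriv (fun s => L (γ (-s))) s = L (-1 • deriv γ (-s)) := by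
      simpa [Function.comp_def] using h2.deriv
    rw [h3]
    simp [hL]
  · simp only [norm_neg, RCLike.norm_conj]
    exact h.norm_atTop.comp tendsto_neg_atBot_atTop
  · simp only [norm_neg, RCLike.norm_conj]
    exact h.norm_atBot.comp tendsto_neg_atTop_atBot
  · exact direction_neg_conj (γ := fun s => γ (-s)) hβ hβ'
      (h.direction_atTop.comp tendsto_neg_atBot_atTop)
  · exact direction_neg_conj (γ := fun s => γ (-s)) hα hα'
      (h.direction_atBot.comp tendsto_neg_atTop_atBot)

theorem exists_saddleContour_neg_one :
    ∃ γ, IsSaddleContour γ (-1) (9 * Real.pi / 10) (13 * Real.pi / 10) := by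
  obtain ⟨γ, h⟩ := exists_saddleContour_one
  refine ⟨fun s => -(starRingEnd ℂ) (γ (-s)), h.isContour.reflect
    (by linarith [cos_sin_thirteen_pi_div_ten.1]) cos_sin_thirteen_pi_div_ten.2.symm
    (by linarith [cos_sin_nine_pi_div_ten.1]) cos_sin_nine_pi_div_ten.2.symm, ?_, fun s hs => ?_⟩
  · simp [h.through]
  · have h1 := h.descent (-s) (neg_ne_zero.2 hs)
    have h2 : (-1 : ℂ) = -(starRingEnd ℂ) 1 := by simp
    rw [h2, fMinus_neg_conj, fMinus_neg_conj]
    simpa using h1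

/-! ### Zeroes of functions `C¹`-close to the cosine -/

/-- Outside `[π/4, 3π/4]` the cosine exceeds `1/2` in modulus, so no zero is possible. Inside, the
sine exceeds `1/2`, so `S` is strictly decreasing, and it changes sign. -/
theorem unique_zero_of_near_cos {S S' : ℝ → ℝ}
    (hd : ∀ y ∈ Set.Icc 0 Real.pi, HasDerivAt S (S' y) y)
    (h : ∀ y ∈ Set.Icc 0 Real.pi, |S y - Real.cos y| < 1 / 2)
    (h' : ∀ y ∈ Set.Icc 0 Real.pi, |S' y + Real.sin y| < 1 / 2) :
    ∃ y ∈ Set.Icc 0 Real.pi, y < Real.pi ∧ S y = 0 ∧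
      ∀ x ∈ Set.Icc 0 Real.pi, S x = 0 → x = y := by
  have hpi := Real.pi_pos
  have hsq : 1 / 2 < √2 / 2 := by
    have : 1 < √2 := Real.lt_sqrt_of_sq_lt (by norm_num)
    linarith
  have hc3 : Real.cos (3 * Real.pi / 4) = -(√2 / 2) := by
    rw [show 3 * Real.pi / 4 = Real.pi - Real.pi / 4 by ring, Real.cos_pi_sub, Real.cos_pi_div_four]
  have hsub : Set.Icc (Real.pi / 4) (3 * Real.pi / 4) ⊆ Set.Icc 0 Real.pi :=
    Set.Icc_subset_Icc (by linarith) (by linarith)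
  have hcont : ContinuousOn S (Set.Icc (Real.pi / 4) (3 * Real.pi / 4)) :=
    fun y hy => (hd y (hsub hy)).continuousAt.continuousWithinAt
  have hloc : ∀ x ∈ Set.Icc 0 Real.pi, S x = 0 →
      x ∈ Set.Icc (Real.pi / 4) (3 * Real.pi / 4) := by
    intro x hx h0
    have h1 := abs_lt.1 (h x hx)
    rw [h0] at h1
    constructor
    · by_contra! hlt
      have := Real.cos_le_cos_of_nonneg_of_le_pi hx.1 (by linarith) hlt.le
      rw [Real.cos_pi_div_four] at this
      linarith
    · by_contra! hlt
      have := Real.cos_le_cos_of_nonneg_of_le_pi (by linarith) hx.2 hlt.le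
      rw [hc3] at this
      linarith
  have hanti : StrictAntiOn S (Set.Icc (Real.pi / 4) (3 * Real.pi / 4)) := by
    refine strictAntiOn_of_deriv_neg (convex_Icc _ _) hcont fun y hy => ?_
    rw [interior_Icc] at hy
    have hy' := hsub (Set.Ioo_subset_Icc_self hy)
    rw [(hd y hy').deriv]
    have h1 := abs_lt.1 (h' y hy')
    have h2 : √2 / 2 ≤ Real.sin y := by
      rw [← Real.cos_sub_pi_div_two, ← Real.cos_abs, ← Real.cos_pi_div_four]
      refine Real.cos_le_cos_of_nonneg_of_le_pi (abs_nonneg _) (by linarith) ?_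
      rw [abs_le]
      constructor <;> linarith [hy.1, hy.2]
    linarith
  have hl : 0 < S (Real.pi / 4) := by
    have := abs_lt.1 (h (Real.pi / 4) ⟨by linarith, by linarith⟩)
    rw [Real.cos_pi_div_four] at this
    linarith
  have hr : S (3 * Real.pi / 4) < 0 := by
    have := abs_lt.1 (h (3 * Real.pi / 4) ⟨by linarith, by linarith⟩)
    rw [hc3] at this
    linarith
  obtain ⟨y, hy, hy0⟩ := intermediate_value_Icc' (by linarith) hcont
    (show (0 : ℝ) ∈ Set.Icc (S (3 * Real.pi / 4)) (S (Real.pi / 4)) from ⟨hr.le, hl.le⟩)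
  refine ⟨y, hsub hy, by linarith [hy.2], hy0, fun x hx hx0 => ?_⟩
  exact hanti.injOn (hloc x hx hx0) hy (hx0.trans hy0.symm)

/-- A function that is `C¹`-asymptotic to the cosine has exactly one zero, near `(2m+1)π/2`, in
each interval `[mπ, (m+1)π)` far out. -/
theorem exists_zero_sequence {R R' : ℝ → ℝ} (hd : ∀ᶠ x in atTop, HasDerivAt R (R' x) x)
    (h : Tendsto (fun x => R x - Real.cos x) atTop (𝓝 0))
    (h' : Tendsto (fun x => R' x + Real.sin x) atTop (𝓝 0)) :
    ∃ (M : ℕ) (θ : ℕ → ℝ), (∀ m, M ≤ m → m * Real.pi ≤ θ m) ∧ StrictMonoOn θ (Set.Ici M) ∧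
      {x | θ M ≤ x ∧ R x = 0} = θ '' Set.Ici M ∧
      Tendsto (fun m : ℕ => θ m - (2 * (m : ℝ) + 1) * Real.pi / 2) atTop (𝓝 0) := by
  have hpi := Real.pi_pos
  have habs : ∀ {f : ℝ → ℝ}, Tendsto f atTop (𝓝 0) → ∀ᶠ x in atTop, |f x| < 1 / 2 := fun hf => by
    simpa using hf.eventually (Metric.ball_mem_nhds 0 (by norm_num : (0 : ℝ) < 1 / 2))
  obtain ⟨T, hT⟩ := eventually_atTop.1 (hd.and ((habs h).and (habs h')))
  obtain ⟨M, hM⟩ := exists_nat_ge (T / Real.pi)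
  rw [div_le_iff₀ hpi] at hM
  have hex : ∀ m : ℕ, M ≤ m → ∃ x, (m : ℝ) * Real.pi ≤ x ∧ x < (m + 1) * Real.pi ∧ R x = 0 ∧
      ∀ w, (m : ℝ) * Real.pi ≤ w → w < (m + 1) * Real.pi → R w = 0 → w = x := by
    intro m hm
    have hge : ∀ y, 0 ≤ y → T ≤ y + m * Real.pi := by
      intro y hy
      have : (M : ℝ) * Real.pi ≤ m * Real.pi := by gcongr
      linarith
    have hε : ((-1 : ℝ) ^ m) * (-1) ^ m = 1 := by rw [← mul_pow]; norm_num
    have hε1 : |(-1 : ℝ) ^ m| = 1 := by simp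
    -- Translation by `mπ` multiplies cosine and sine by `(-1)^m`. Undoing this sign reduces every
    -- interval to `[0, π]`.
    obtain ⟨y, hy, hypi, hy0, huniq⟩ := unique_zero_of_near_cos
      (S := fun y => (-1) ^ m * R (y + m * Real.pi))
      (S' := fun y => (-1) ^ m * R' (y + m * Real.pi))
      (fun y hy => ((hT _ (hge y hy.1)).1.comp_add_const y _).const_mul _)
      (fun y hy => by
        have h1 := (hT _ (hge y hy.1)).2.1
        rw [Real.cos_add_nat_mul_pi] at h1
        calc _ = |(-1 : ℝ) ^ m * (R (y + m * Real.pi) - (-1) ^ m * Real.cos y)| := by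
              rw [mul_sub, ← mul_assoc, hε, one_mul]
          _ < _ := by rwa [abs_mul, hε1, one_mul])
      (fun y hy => by
        have h1 := (hT _ (hge y hy.1)).2.2
        rw [Real.sin_add_nat_mul_pi] at h1
        calc _ = |(-1 : ℝ) ^ m * (R' (y + m * Real.pi) + (-1) ^ m * Real.sin y)| := by
              rw [mul_add, ← mul_assoc, hε, one_mul]
          _ < _ := by rwa [abs_mul, hε1, one_mul])
    have hne : (-1 : ℝ) ^ m ≠ 0 := by simp
    refine ⟨y + m * Real.pi, by linarith [hy.1], by linarith, ?_, fun w hw1 hw2 hw0 => ?_⟩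
    · exact (mul_eq_zero.1 hy0).resolve_left hne
    · have := huniq (w - m * Real.pi) ⟨by linarith, by linarith⟩ (by simp [hw0])
      linarith
  choose! θ hθ1 hθ2 hθ3 hθ4 using hex
  have hmono : StrictMonoOn θ (Set.Ici M) := by
    intro m hm n hn hmn
    have h1 : ((m : ℝ) + 1) * Real.pi ≤ n * Real.pi := by
      have : (m : ℝ) + 1 ≤ n := by exact_mod_cast hmn
      gcongr
    linarith [hθ2 m hm, hθ1 n hn]
  refine ⟨M, θ, hθ1, hmono, ?_, ?_⟩
  · ext x
    constructor
    · rintro ⟨hx1, hx0⟩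
      have hxM : (M : ℝ) * Real.pi ≤ x := (hθ1 M le_rfl).trans hx1
      have hx : 0 ≤ x / Real.pi := div_nonneg (le_trans (by positivity) hxM) hpi.le
      have hfl := Nat.floor_le hx
      have hlt := Nat.lt_floor_add_one (x / Real.pi)
      rw [le_div_iff₀ hpi] at hfl
      rw [div_lt_iff₀ hpi] at hlt
      have hm : M ≤ ⌊x / Real.pi⌋₊ := Nat.le_floor (by rwa [le_div_iff₀ hpi])
      exact ⟨_, hm, (hθ4 _ hm x hfl hlt hx0).symm⟩
    · rintro ⟨m, hm, rfl⟩
      exact ⟨hmono.monotoneOn (Set.self_mem_Ici) hm hm, hθ3 m hm⟩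
  · have hθtop : Tendsto θ atTop atTop := by
      refine tendsto_atTop_mono' _ ?_ (tendsto_natCast_atTop_atTop.atTop_mul_const hpi)
      filter_upwards [eventually_ge_atTop M] with m hm using hθ1 m hm
    -- At a zero of `R` the cosine tends to zero. Shifted by `mπ`, the zero lies in `[0, π)`, where
    -- `arccos` inverts the cosine and is continuous, so the shifted zero tends to `π/2`.
    have h1 : Tendsto (fun m => |R (θ m) - Real.cos (θ m)|) atTop (𝓝 0) := by
      simpa using (h.comp hθtop).abs
    have h2 : Tendsto (fun m : ℕ => |Real.cos (θ m - m * Real.pi)|) atTop (𝓝 0) := by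
      refine h1.congr' ?_
      filter_upwards [eventually_ge_atTop M] with m hm
      rw [hθ3 m hm, zero_sub, abs_neg, Real.cos_sub_nat_mul_pi, abs_mul]
      simp
    have h3 := (Real.continuous_arccos.tendsto 0).comp ((tendsto_zero_iff_abs_tendsto_zero _).2 h2)
    rw [Real.arccos_zero] at h3
    have h4 := h3.sub_const (Real.pi / 2)
    rw [sub_self] at h4
    refine h4.congr' ?_
    filter_upwards [eventually_ge_atTop M] with m hm
    simp only [Function.comp_apply]
    rw [Real.arccos_cos (by linarith [hθ1 m hm]) (by linarith [hθ2 m hm])]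
    ring

/-- The increasing change of variable `x = 4λ/5 - π/4` with `λ = |z|^{5/4}` carries the zeroes of
`q` to those of a function `C¹`-close to `cos x`. The prefactor `A` never vanishes, and `z ↦ λ`
reverses order on the negative axis. -/
theorem exists_negative_zeros {q : ℝ → ℂ} {A N N' : ℝ → ℝ}
    (hq : ∀ z < 0, q z = ((A z * N (|z| ^ (5 / 4 : ℝ)) : ℝ) : ℂ)) (hA : ∀ z < 0, A z ≠ 0)
    (hd : ∀ x, 0 < x → HasDerivAt N (N' x) x)
    (h : Tendsto (fun x => N x - Real.cos (4 * x / 5 - Real.pi / 4)) atTop (𝓝 0))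
    (h' : Tendsto (fun x => N' x + 4 / 5 * Real.sin (4 * x / 5 - Real.pi / 4)) atTop (𝓝 0)) :
    ∃ (M : ℕ) (ζ : ℕ → ℝ), ζ M < 0 ∧ StrictAntiOn ζ (Set.Ici M) ∧
      {z : ℝ | z ≤ ζ M ∧ q z = 0} = ζ '' Set.Ici M ∧
      Tendsto (fun m : ℕ => (4 * |ζ m| ^ (5 / 4 : ℝ) / 5 - Real.pi / 4) -
        (2 * (m : ℝ) + 1) * Real.pi / 2) atTop (𝓝 0) ∧
      ζ ~[atTop] approxNegZero := by
  have hpi := Real.pi_pos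
  set u : ℝ → ℝ := fun x => 5 / 4 * (x + Real.pi / 4) with hu
  have hutop : Tendsto u atTop atTop :=
    (tendsto_atTop_add_const_right _ _ tendsto_id).const_mul_atTop (by norm_num)
  have hu4 : ∀ x, 4 * u x / 5 - Real.pi / 4 = x := fun x => by
    simp only [hu]
    ring
  have hud : ∀ x, HasDerivAt u (5 / 4) x := fun x => by
    simpa using ((hasDerivAt_id x).add_const (Real.pi / 4)).const_mul (5 / 4 : ℝ)
  obtain ⟨M, θ, hθ1, hmono, hset, hlim⟩ := exists_zero_sequence
    (R := fun x => N (u x)) (R' := fun x => N' (u x) * (5 / 4))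
    (by
      filter_upwards [hutop.eventually_gt_atTop 0] with x hx
      exact (hd _ hx).comp x (hud x))
    ((h.comp hutop).congr fun x => by simp only [Function.comp_apply, hu4])
    (by
      have := (h'.comp hutop).mul_const (5 / 4)
      rw [zero_mul] at this
      refine this.congr fun x => ?_
      simp only [Function.comp_apply, hu4]
      ring)
  set ζ : ℕ → ℝ := fun m => -(u (θ m) ^ (4 / 5 : ℝ)) with hζ
  have hupos : ∀ m, M ≤ m → 0 < u (θ m) := by
    intro m hm
    have := hθ1 m hm
    have : 0 ≤ (m : ℝ) * Real.pi := by positivity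
    simp only [hu]
    linarith
  have hζneg : ∀ m, M ≤ m → ζ m < 0 := fun m hm =>
    neg_lt_zero.2 (Real.rpow_pos_of_pos (hupos m hm) _)
  have hζabs : ∀ m, M ≤ m → |ζ m| ^ (5 / 4 : ℝ) = u (θ m) := by
    intro m hm
    simp only [hζ]
    rw [abs_neg, abs_of_pos (Real.rpow_pos_of_pos (hupos m hm) _), ← Real.rpow_mul (hupos m hm).le]
    norm_num
  have hanti : StrictAntiOn ζ (Set.Ici M) := by
    intro m hm n hn hmn
    have h1 : u (θ m) < u (θ n) := by
      have := hmono hm hn hmn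
      simp only [hu]
      linarith
    exact neg_lt_neg (Real.rpow_lt_rpow (hupos m hm).le h1 (by norm_num))
  have hzero : ∀ z < 0, (q z = 0 ↔ N (|z| ^ (5 / 4 : ℝ)) = 0) := by
    intro z hz
    rw [hq z hz, Complex.ofReal_eq_zero, mul_eq_zero, or_iff_right (hA z hz)]
  refine ⟨M, ζ, hζneg M le_rfl, hanti, ?_, ?_, ?_⟩
  · ext z
    constructor
    · rintro ⟨hz1, hz0⟩
      have hz : z < 0 := hz1.trans_lt (hζneg M le_rfl)
      have hz2 := (hzero z hz).1 hz0
      set x := 4 * |z| ^ (5 / 4 : ℝ) / 5 - Real.pi / 4 with hx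
      have hux : u x = |z| ^ (5 / 4 : ℝ) := by
        simp only [hu, hx]
        ring
      have hle : θ M ≤ x := by
        have h1 : |ζ M| ^ (5 / 4 : ℝ) ≤ |z| ^ (5 / 4 : ℝ) := by
          refine Real.rpow_le_rpow (abs_nonneg _) ?_ (by norm_num)
          rw [abs_of_neg hz, abs_of_neg (hζneg M le_rfl)]
          linarith
        rw [hζabs M le_rfl, ← hux] at h1
        simp only [hu] at h1
        linarith
      have hmem : x ∈ θ '' Set.Ici M := by
        rw [← hset]
        exact ⟨hle, by simpa only [hux] using hz2⟩
      obtain ⟨m, hm, hmx⟩ := hmem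
      refine ⟨m, hm, ?_⟩
      simp only [hζ]
      rw [hmx, hux, ← Real.rpow_mul (abs_nonneg z), abs_of_neg hz]
      norm_num
    · rintro ⟨m, hm, rfl⟩
      refine ⟨hanti.antitoneOn Set.self_mem_Ici hm hm, (hzero _ (hζneg m hm)).2 ?_⟩
      rw [hζabs m hm]
      have : θ m ∈ {x | θ M ≤ x ∧ N (u x) = 0} := by
        rw [hset]
        exact ⟨m, hm, rfl⟩
      exact this.2
  · refine hlim.congr' ?_
    filter_upwards [eventually_ge_atTop M] with m hm
    rw [hζabs m hm, hu4]
  · set a : ℕ → ℝ := fun m => 5 / 4 * (Real.pi / 4 + (2 * (m : ℝ) + 1) * Real.pi / 2) with ha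
    have hapos : ∀ m, 0 < a m := fun m => by positivity
    have hatop : Tendsto a atTop atTop := by
      refine Tendsto.const_mul_atTop (by norm_num) (tendsto_atTop_add_const_left _ _ ?_)
      refine Tendsto.atTop_div_const two_pos (Tendsto.atTop_mul_const hpi ?_)
      exact tendsto_atTop_add_const_right _ _
        (tendsto_natCast_atTop_atTop.const_mul_atTop two_pos)
    -- The difference `u (θ m) - a m` tends to zero while `a m` tends to infinity. The ratio limit
    -- survives the power `4/5`.
    have h1 : Tendsto (fun m => u (θ m) / a m) atTop (𝓝 1) := by
      have h2 := ((hlim.const_mul (5 / 4)).div_atTop hatop).add_const 1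
      rw [zero_add] at h2
      refine h2.congr fun m => ?_
      have := (hapos m).ne'
      rw [div_add_one this]
      congr 1
      simp only [hu, ha]
      ring
    have h3 := h1.rpow_const (p := (4 / 5 : ℝ)) (Or.inl one_ne_zero)
    rw [Real.one_rpow] at h3
    refine isEquivalent_of_tendsto_one (h3.congr' ?_)
    filter_upwards [eventually_ge_atTop M] with m hm
    rw [Real.div_rpow (hupos m hm).le (hapos m).le, Pi.div_apply, approxNegZero, neg_div_neg_eq]

/-! ### Leading constants and amplitudes at the saddles -/

/-- The limit of `√λ e^{4iλ/5} J₀(λ)`. -/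
noncomputable def saddleConst : ℂ :=
  (√(Real.pi / 2) : ℂ) * Complex.exp ((Real.pi / 4 : ℝ) * Complex.I)

/-- `√λ e^{4iλ/5} J₀(λ)`. -/
noncomputable def amplitudeOne (lam : ℝ) : ℂ :=
  (√lam : ℂ) * halfIntegral 1 rightDir 0 lam -
    (√lam : ℂ) * halfIntegral 1 (-1 / 4 - Complex.I) lowerDir lam

/-- Half of `√λ e^{4λ/5} J₃(λ)`, up to an imaginary part. -/
noncomputable def amplitudeNegI (lam : ℝ) : ℂ :=
  (√lam : ℂ) * halfIntegral (-Complex.I) 1 lowerDir lam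

theorem sqrt_pi_div_two_pos : 0 < √(Real.pi / 2) := Real.sqrt_pos.2 (by positivity)

theorem sqrt_pi_div_two_sq : (√(Real.pi / 2) : ℂ) ^ 2 = Real.pi / 2 := by
  rw [← Complex.ofReal_pow, Real.sq_sqrt (by positivity)]
  push_cast
  rfl

theorem saddleConst_sq : saddleConst ^ 2 = Real.pi / 2 * Complex.I := by
  have h : ((2 : ℕ) : ℂ) * ((Real.pi / 4 : ℝ) * Complex.I) = Real.pi / 2 * Complex.I := by
    push_cast
    ring
  rw [saddleConst, mul_pow, sqrt_pi_div_two_sq, ← Complex.exp_nat_mul, h,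
    Complex.exp_pi_div_two_mul_I]

theorem saddleConst_ne_zero : saddleConst ≠ 0 :=
  mul_ne_zero (Complex.ofReal_ne_zero.2 sqrt_pi_div_two_pos.ne') (Complex.exp_ne_zero _)

theorem right_const : ∃ W : ℂ, 0 < W.re ∧
    W ^ 2 * (-2 * Complex.I * 1 ^ 3 * rightDir ^ 2) = Real.pi ∧ rightDir * W = saddleConst := by
  have hne : rightDir ≠ 0 := Complex.exp_ne_zero _
  refine ⟨saddleConst / rightDir, ?_, ?_, mul_div_cancel₀ _ hne⟩
  · rw [saddleConst, rightDir, mul_div_assoc, ← Complex.exp_sub, ← sub_mul, ← Complex.ofReal_sub,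
      Complex.re_ofReal_mul, Complex.exp_ofReal_mul_I_re]
    refine mul_pos sqrt_pi_div_two_pos (Real.cos_pos_of_mem_Ioo ?_)
    constructor <;> linarith [Real.pi_pos]
  · rw [div_pow, saddleConst_sq, div_mul_eq_mul_div, div_eq_iff (pow_ne_zero 2 hne)]
    linear_combination (-(Real.pi : ℂ) * rightDir ^ 2) * Complex.I_sq

/-- The incoming side of the saddle leaves `1` in the opposite direction, so the same square root
appears with the opposite sign. Subtracting the two halves in `amplitudeOne` makes them add up. -/
theorem lower_one_const : ∃ W : ℂ, 0 < W.re ∧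
    W ^ 2 * (-2 * Complex.I * 1 ^ 3 * (-1 / 4 - Complex.I) ^ 2) = Real.pi ∧
    (-1 / 4 - Complex.I) * W = -saddleConst := by
  have him : (-1 / 4 - Complex.I : ℂ).im = -1 := by simp
  have hre : (-1 / 4 - Complex.I : ℂ).re = -1 / 4 := by simp
  have hne : (-1 / 4 - Complex.I : ℂ) ≠ 0 := by
    intro h
    rw [h] at him
    simp at him
  refine ⟨-saddleConst / (-1 / 4 - Complex.I), ?_, ?_, mul_div_cancel₀ _ hne⟩
  · obtain ⟨h1, h2⟩ := exp_mul_I_re_im (Real.pi / 4)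
    have h3 : saddleConst.re = √(Real.pi / 2) * (√2 / 2) := by
      rw [saddleConst, Complex.re_ofReal_mul, h1, Real.cos_pi_div_four]
    have h4 : saddleConst.im = √(Real.pi / 2) * (√2 / 2) := by
      rw [saddleConst, Complex.im_ofReal_mul, h2, Real.sin_pi_div_four]
    have hn := Complex.normSq_pos.2 hne
    have hp : 0 < √(Real.pi / 2) * (√2 / 2) := mul_pos sqrt_pi_div_two_pos (by positivity)
    rw [Complex.div_re, Complex.neg_re, Complex.neg_im, him, hre, h3, h4, ← add_div]
    refine div_pos ?_ hn
    linarith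
  · rw [div_pow, neg_sq, saddleConst_sq, div_mul_eq_mul_div, div_eq_iff (pow_ne_zero 2 hne)]
    linear_combination (-(Real.pi : ℂ) * (-1 / 4 - Complex.I) ^ 2) * Complex.I_sq

theorem neg_I_const : ∃ W : ℂ, 0 < W.re ∧
    W ^ 2 * (-2 * Complex.I * (-Complex.I) ^ 3 * 1 ^ 2) = Real.pi ∧
    1 * W = (√(Real.pi / 2) : ℂ) := by
  refine ⟨(√(Real.pi / 2) : ℂ), by simpa using Real.pi_pos, ?_, one_mul _⟩
  rw [sqrt_pi_div_two_sq]
  linear_combination (Real.pi : ℂ) * Complex.I_pow_four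

theorem tendsto_amplitudeOne : Tendsto amplitudeOne atTop (𝓝 saddleConst) := by
  obtain ⟨W, h1, h2, h3⟩ := right_const
  obtain ⟨X, k1, k2, k3⟩ := lower_one_const
  have := (isHalfPath_right.tendsto h1 h2).sub (isHalfPath_lower_one.tendsto k1 k2)
  have he : saddleConst / 2 - -saddleConst / 2 = saddleConst := by ring
  rw [h3, k3, he] at this
  exact this

theorem tendsto_amplitudeNegI :
    Tendsto amplitudeNegI atTop (𝓝 ((√(Real.pi / 2) / 2 : ℝ) : ℂ)) := by
  obtain ⟨W, h1, h2, h3⟩ := neg_I_const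
  have := isHalfPath_lower_neg_I.tendsto h1 h2
  have he : (√(Real.pi / 2) : ℂ) / 2 = ((√(Real.pi / 2) / 2 : ℝ) : ℂ) := by
    push_cast
    rfl
  rw [h3, he] at this
  exact this

theorem exists_deriv_amplitudeOne : ∃ D : ℝ → ℂ, Tendsto D atTop (𝓝 0) ∧
    ∀ lam : ℝ, 0 < lam → HasDerivAt amplitudeOne (D lam) lam := by
  obtain ⟨W, h1, h2, -⟩ := right_const
  obtain ⟨X, k1, k2, -⟩ := lower_one_const
  obtain ⟨D, hD, hd⟩ := isHalfPath_right.exists_deriv h1 h2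
  obtain ⟨E, hE, he⟩ := isHalfPath_lower_one.exists_deriv k1 k2
  exact ⟨fun x => D x - E x, by simpa using hD.sub hE,
    fun lam hlam => (hd lam hlam).sub (he lam hlam)⟩

theorem exists_deriv_amplitudeNegI : ∃ D : ℝ → ℂ, Tendsto D atTop (𝓝 0) ∧
    ∀ lam : ℝ, 0 < lam → HasDerivAt amplitudeNegI (D lam) lam := by
  obtain ⟨W, h1, h2, -⟩ := neg_I_const
  exact isHalfPath_lower_neg_I.exists_deriv h1 h2

theorem cexp_fMinus_one (lam : ℝ) : Complex.exp (Complex.I * lam * fMinus 1) =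
    Complex.exp ((-(4 * lam / 5) : ℝ) * Complex.I) := by
  congr 1
  unfold fMinus
  push_cast
  ring

theorem cexp_fMinus_neg_I (lam : ℝ) : Complex.exp (Complex.I * lam * fMinus (-Complex.I)) =
    (Real.exp (-(4 * lam / 5)) : ℂ) := by
  rw [Complex.ofReal_exp]
  congr 1
  unfold fMinus
  push_cast
  linear_combination (-(lam : ℂ) / 5 * (Complex.I ^ 4 - Complex.I ^ 2 + 1) + lam) * Complex.I_sq

section ValleyValues

variable {lam : ℝ} {F : ℂ → ℂ} {VE VP : ℂ}

/-- Both limits are reached from `1` along half paths, and `F(1)` cancels in the difference. -/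
theorem HasValleyLimits.sub_eq (h : HasValleyLimits F VE VP) (hF : IsPhasePrimitive lam F)
    (hlam : 0 < lam) : VE - VP =
      Complex.exp ((-(4 * lam / 5) : ℝ) * Complex.I) * ((√lam : ℂ)⁻¹ * amplitudeOne lam) := by
  have hs : (√lam : ℂ) ≠ 0 := Complex.ofReal_ne_zero.2 (Real.sqrt_pos.2 hlam).ne'
  have hE : rightDir / (‖rightDir‖ : ℂ) = Complex.exp ((Real.pi / 10 : ℝ) * Complex.I) := by
    rw [rightDir, Complex.norm_exp_ofReal_mul_I, Complex.ofReal_one, div_one]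
  have hg := gluedPath_atTop_of_line (t₀ := 1) (b₁ := 0) (b₂ := 0) (a₁ := rightDir)
    (Complex.exp_ne_zero _)
  have hk := gluedPath_atTop (t₀ := 1) (b₁ := 0) (b₂ := 0) (a₁ := -1 / 4 - Complex.I)
    lowerDir_ne_zero
  rw [hE] at hg
  rw [lowerDir_direction] at hk
  have h1 := isHalfPath_right.primitive_limit hlam hF (V := VE) (by
    refine (h.tendsto_right hg.1 hg.2).congr' ?_
    filter_upwards [eventually_ge_atTop 0] with s hs
    rw [gluedPath_pos hs])
  have h2 := isHalfPath_lower_one.primitive_limit hlam hF (V := VP) (by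
    refine (h.tendsto_lower hk.1 hk.2).congr' ?_
    filter_upwards [eventually_ge_atTop 0] with s hs
    rw [gluedPath_pos hs])
  rw [cexp_fMinus_one] at h1 h2
  rw [amplitudeOne, ← mul_sub, inv_mul_cancel_left₀ hs]
  linear_combination h1 - h2

/-- The reflection fixes `-i`, so `F(-i)` is purely imaginary. One half path from `-i` therefore
determines `Re VP`. -/
theorem HasValleyLimits.lower_re (h : HasValleyLimits F VE VP) (hF : IsPhasePrimitive lam F)
    (hlam : 0 < lam) :
    VP.re = Real.exp (-(4 * lam / 5)) * ((√lam)⁻¹ * (amplitudeNegI lam).re) := by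
  have hs := (Real.sqrt_pos.2 hlam).ne'
  have hk := gluedPath_atTop (t₀ := -Complex.I) (b₁ := 0) (b₂ := 0) (a₁ := 1) lowerDir_ne_zero
  rw [lowerDir_direction] at hk
  have h1 := isHalfPath_lower_neg_I.primitive_limit hlam hF (V := VP) (by
    refine (h.tendsto_lower hk.1 hk.2).congr' ?_
    filter_upwards [eventually_ge_atTop 0] with s hs
    rw [gluedPath_pos hs])
  have h2 : (F (-Complex.I)).re = 0 := by
    have := congrArg Complex.re (hF.neg_conj (-Complex.I))
    simp only [map_neg, Complex.conj_I, neg_neg, Complex.neg_re, Complex.conj_re] at this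
    linarith
  rw [cexp_fMinus_neg_I] at h1
  have h3 := congrArg Complex.re h1
  rw [Complex.sub_re, h2, sub_zero, Complex.re_ofReal_mul] at h3
  rw [h3, amplitudeNegI, Complex.re_ofReal_mul, inv_mul_cancel_left₀ hs]

end ValleyValues

/-! ### The normalized integral and its derivative -/

/-- The normalized swallowtail integral `Q / (|z|^{1/4} √(2π/λ))` as a function of `λ`. -/
noncomputable def normalizedQ (lam : ℝ) : ℝ :=
  (√(Real.pi / 2))⁻¹ * (Complex.exp ((-(4 * lam / 5) : ℝ) * Complex.I) * amplitudeOne lam +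
    (Real.exp (-(4 * lam / 5)) : ℂ) * amplitudeNegI lam).re

theorem sqrt_two_pi_div (lam : ℝ) :
    √(2 * Real.pi / lam) = 2 * √(Real.pi / 2) * (√lam)⁻¹ := by
  have h : 2 * Real.pi / lam = 2 ^ 2 * (Real.pi / 2) / lam := by ring
  rw [h, Real.sqrt_div (by positivity), Real.sqrt_mul (by norm_num), Real.sqrt_sq (by norm_num),
    div_eq_mul_inv]

/-- `Re VE = Re (VE - VP) + Re VP`: the first term is the oscillating contribution of the real
saddles, the second the exponentially small one of `-i`. -/
theorem HasValleyLimits.two_mul_re {lam : ℝ} {F : ℂ → ℂ} {VE VP : ℂ}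
    (h : HasValleyLimits F VE VP) (hF : IsPhasePrimitive lam F) (hlam : 0 < lam) :
    2 * VE.re = √(2 * Real.pi / lam) * normalizedQ lam := by
  have h1 := congrArg Complex.re (h.sub_eq hF hlam)
  have h2 := h.lower_re hF hlam
  rw [← Complex.ofReal_inv, mul_left_comm, Complex.re_ofReal_mul, Complex.sub_re] at h1
  have hne := sqrt_pi_div_two_pos.ne'
  rw [sqrt_two_pi_div, normalizedQ, Complex.add_re, Complex.re_ofReal_mul]
  field_simp
  rw [inv_eq_one_div] at h1 h2
  have h3 : VE.re = 1 / √lam * (Complex.exp ((-(4 * lam / 5) : ℝ) * Complex.I) *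
      amplitudeOne lam).re + Real.exp (-(4 * lam / 5)) * (1 / √lam * (amplitudeNegI lam).re) := by
    linarith
  have hs := (Real.sqrt_pos.2 hlam).ne'
  rw [h3]
  field_simp

theorem cexp_mul_saddleConst (lam : ℝ) :
    Complex.exp ((-(4 * lam / 5) : ℝ) * Complex.I) * saddleConst = (√(Real.pi / 2) : ℂ) *
      Complex.exp ((-(4 * lam / 5 - Real.pi / 4) : ℝ) * Complex.I) := by
  rw [saddleConst, mul_left_comm, ← Complex.exp_add]
  congr 2
  push_cast
  ring

theorem tendsto_exp_neg_four_fifths :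
    Tendsto (fun lam : ℝ => (Real.exp (-(4 * lam / 5)) : ℂ)) atTop (𝓝 0) := by
  refine (Complex.continuous_ofReal.tendsto' 0 0 Complex.ofReal_zero).comp
    (Real.tendsto_exp_neg_atTop_nhds_zero.comp ?_)
  exact (tendsto_id.const_mul_atTop (by norm_num : (0 : ℝ) < 4)).atTop_div_const (by norm_num)

theorem tendsto_cexp_mul_zero {f : ℝ → ℂ} (hf : Tendsto f atTop (𝓝 0)) :
    Tendsto (fun lam : ℝ => Complex.exp ((-(4 * lam / 5) : ℝ) * Complex.I) * f lam) atTop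
      (𝓝 0) := by
  rw [tendsto_zero_iff_norm_tendsto_zero] at hf ⊢
  simpa only [norm_mul, Complex.norm_exp_ofReal_mul_I, one_mul] using hf

theorem tendsto_normalizedQ : Tendsto
    (fun x => normalizedQ x - Real.cos (4 * x / 5 - Real.pi / 4)) atTop (𝓝 0) := by
  have h1 : Tendsto (fun lam => amplitudeOne lam - saddleConst) atTop (𝓝 0) := by
    simpa using tendsto_amplitudeOne.sub_const saddleConst
  have h2 := (tendsto_cexp_mul_zero h1).add (tendsto_exp_neg_four_fifths.mul tendsto_amplitudeNegI)
  rw [zero_mul, add_zero] at h2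
  have h3 := ((Complex.continuous_re.tendsto' 0 0 Complex.zero_re).comp h2).const_mul
    (√(Real.pi / 2))⁻¹
  rw [mul_zero] at h3
  refine h3.congr fun x => ?_
  simp only [Function.comp_apply]
  rw [mul_sub, cexp_mul_saddleConst, sub_add_eq_add_sub, Complex.sub_re, mul_sub, normalizedQ,
    Complex.re_ofReal_mul, Complex.exp_ofReal_mul_I_re, Real.cos_neg,
    inv_mul_cancel_left₀ sqrt_pi_div_two_pos.ne']

/-- The amplitudes have derivatives tending to zero, so in the limit only the oscillating factor
`exp(-4iλ/5)` is differentiated, which turns the cosine into `-4/5` times the sine. -/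
theorem exists_deriv_normalizedQ : ∃ N' : ℝ → ℝ,
    (∀ x, 0 < x → HasDerivAt normalizedQ (N' x) x) ∧
    Tendsto (fun x => N' x + 4 / 5 * Real.sin (4 * x / 5 - Real.pi / 4)) atTop (𝓝 0) := by
  obtain ⟨D, hD, hd⟩ := exists_deriv_amplitudeOne
  obtain ⟨E, hE, he⟩ := exists_deriv_amplitudeNegI
  have hlin : ∀ x : ℝ, HasDerivAt (fun x : ℝ => -(4 * x / 5)) (-(4 / 5)) x := fun x =>
    (((hasDerivAt_id x).const_mul 4).div_const 5).neg.congr_deriv (by norm_num)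
  set Z' : ℝ → ℂ := fun x =>
    Complex.exp ((-(4 * x / 5) : ℝ) * Complex.I) * (D x - 4 / 5 * Complex.I * amplitudeOne x) +
      (Real.exp (-(4 * x / 5)) : ℂ) * (E x - 4 / 5 * amplitudeNegI x) with hZ'
  refine ⟨fun x => (√(Real.pi / 2))⁻¹ * (Z' x).re, fun x hx => ?_, ?_⟩
  · have h1 : HasDerivAt (fun x : ℝ => Complex.exp ((-(4 * x / 5) : ℝ) * Complex.I))
        (Complex.exp ((-(4 * x / 5) : ℝ) * Complex.I) * ((-(4 / 5) : ℝ) * Complex.I)) x :=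
      ((hlin x).ofReal_comp.mul_const Complex.I).cexp
    have h2 := (hlin x).exp.ofReal_comp
    have h3 := (h1.mul (hd x hx)).add (h2.mul (he x hx))
    have h4 := ((Complex.reCLM.hasFDerivAt.comp_hasDerivAt x h3)).const_mul (√(Real.pi / 2))⁻¹
    refine h4.congr_deriv ?_
    rw [Complex.reCLM_apply]
    congr 2
    simp only [hZ']
    push_cast
    ring
  · have h1 : Tendsto (fun x => D x - 4 / 5 * Complex.I * (amplitudeOne x - saddleConst))
        atTop (𝓝 0) := by
      have := hD.sub ((tendsto_amplitudeOne.sub_const saddleConst).const_mul (4 / 5 * Complex.I))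
      simpa using this
    have h2 := (tendsto_cexp_mul_zero h1).add
      (tendsto_exp_neg_four_fifths.mul (hE.sub (tendsto_amplitudeNegI.const_mul (4 / 5))))
    rw [zero_mul, add_zero] at h2
    have h3 := ((Complex.continuous_re.tendsto' 0 0 Complex.zero_re).comp h2).const_mul
      (√(Real.pi / 2))⁻¹
    rw [mul_zero] at h3
    refine h3.congr fun x => ?_
    have h5 : Complex.exp ((-(4 * x / 5) : ℝ) * Complex.I) *
        (D x - 4 / 5 * Complex.I * (amplitudeOne x - saddleConst)) +
        (Real.exp (-(4 * x / 5)) : ℂ) * (E x - 4 / 5 * amplitudeNegI x) =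
        Z' x + ((4 / 5 * √(Real.pi / 2) : ℝ) : ℂ) *
          (Complex.I * Complex.exp ((-(4 * x / 5 - Real.pi / 4) : ℝ) * Complex.I)) := by
      have := cexp_mul_saddleConst x
      simp only [hZ']
      push_cast at this ⊢
      linear_combination 4 / 5 * Complex.I * this
    simp only [Function.comp_apply]
    rw [h5, Complex.add_re, Complex.re_ofReal_mul, Complex.I_mul_re, Complex.exp_ofReal_mul_I_im,
      Real.sin_neg, neg_neg]
    have := sqrt_pi_div_two_pos.ne'
    field_simp

theorem hasImproperIntegral_swallowtail {z : ℝ} (hz : z < 0) :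
    HasImproperIntegral (swallowtailIntegrand 0 0 z)
      ((|z| ^ (1 / 4 : ℝ) * √(2 * Real.pi / |z| ^ (5 / 4 : ℝ)) *
        normalizedQ (|z| ^ (5 / 4 : ℝ)) : ℝ) : ℂ) := by
  have hlam : 0 < |z| ^ (5 / 4 : ℝ) := Real.rpow_pos_of_pos (abs_pos.2 hz.ne) _
  obtain ⟨F, hF⟩ := exists_isPhasePrimitive (|z| ^ (5 / 4 : ℝ))
  obtain ⟨VE, VP, h⟩ := exists_hasValleyLimits hlam hF
  have := h.swallowtail hz hF
  rwa [h.two_mul_re hF hlam, ← mul_assoc] at this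

theorem swallowtailQ_eq {z : ℝ} (hz : z < 0) : swallowtailQ 0 0 z =
    ((|z| ^ (1 / 4 : ℝ) * √(2 * Real.pi / |z| ^ (5 / 4 : ℝ)) *
      normalizedQ (|z| ^ (5 / 4 : ℝ)) : ℝ) : ℂ) :=
  (hasImproperIntegral_swallowtail hz).improperIntegral_eq

theorem swallowtailQ_isLittleO : (fun z : ℝ => swallowtailQ 0 0 z -
      ((|z| ^ (1 / 4 : ℝ) * √(2 * Real.pi / |z| ^ (5 / 4 : ℝ)) *
        Real.cos (4 * |z| ^ (5 / 4 : ℝ) / 5 - Real.pi / 4) : ℝ) : ℂ))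
    =o[atBot] (fun z : ℝ => |z| ^ (1 / 4 : ℝ) * √(2 * Real.pi / |z| ^ (5 / 4 : ℝ))) := by
  have htop : Tendsto (fun z : ℝ => |z| ^ (5 / 4 : ℝ)) atBot atTop :=
    (tendsto_rpow_atTop (by norm_num)).comp tendsto_abs_atBot_atTop
  have h1 := (isLittleO_one_iff ℝ).2 (tendsto_normalizedQ.comp htop)
  have h2 := (isBigO_refl (fun z : ℝ => |z| ^ (1 / 4 : ℝ) * √(2 * Real.pi / |z| ^ (5 / 4 : ℝ)))
    atBot).mul_isLittleO h1
  simp only [mul_one] at h2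
  refine IsLittleO.of_norm_left (h2.norm_left.congr' ?_ EventuallyEq.rfl)
  filter_upwards [eventually_lt_atBot 0] with z hz
  rw [swallowtailQ_eq hz, ← Complex.ofReal_sub, Complex.norm_real, ← mul_sub]
  rfl

/-! ### Asymptotics of the saddle integrals and conclusion -/

theorem sqrt_pi_div_two_mul {lam : ℝ} :
    √(Real.pi / (2 * lam)) = √(Real.pi / 2) * (√lam)⁻¹ := by
  rw [← div_div, Real.sqrt_div (by positivity), div_eq_mul_inv]

theorem isEquivalent_mul_of_tendsto {J A p : ℝ → ℂ} {a : ℂ} (ha : a ≠ 0)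
    (hA : Tendsto A atTop (𝓝 a)) (hJ : ∀ x, 0 < x → J x = p x * A x) :
    J ~[atTop] fun x => p x * a := by
  refine ((IsEquivalent.refl (u := p)).mul
    ((isEquivalent_const_iff_tendsto ha).2 hA)).congr_left ?_
  filter_upwards [eventually_gt_atTop 0] with x hx using (hJ x hx).symm

section Contours

variable {γ₂ γ₃ γ₀ : ℝ → ℂ}

theorem saddleIntegral_one_isEquivalent
    (hγ : IsContour γ₀ (17 * Real.pi / 10) (Real.pi / 10)) :
    saddleIntegral γ₀ ~[atTop] (fun lam : ℝ => ((√(Real.pi / (2 * lam)) : ℝ) : ℂ) *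
      Complex.exp (((-(4 * lam / 5) + Real.pi / 4 : ℝ) : ℂ) * Complex.I)) := by
  have := isEquivalent_mul_of_tendsto (J := saddleIntegral γ₀)
    (p := fun lam : ℝ => Complex.exp ((-(4 * lam / 5) : ℝ) * Complex.I) * (√lam : ℂ)⁻¹)
    saddleConst_ne_zero tendsto_amplitudeOne fun lam hlam => by
      obtain ⟨F, hF⟩ := exists_isPhasePrimitive lam
      obtain ⟨VE, VP, h⟩ := exists_hasValleyLimits hlam hF
      rw [saddleIntegral, (h.saddle_one hF hγ).improperIntegral_eq, h.sub_eq hF hlam, mul_assoc]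
  refine this.congr_right (Eventually.of_forall fun lam => ?_)
  simp only
  rw [mul_right_comm, cexp_mul_saddleConst, sqrt_pi_div_two_mul, neg_sub, sub_eq_neg_add]
  push_cast
  ring

theorem saddleIntegral_neg_one_isEquivalent
    (hγ : IsContour γ₂ (9 * Real.pi / 10) (13 * Real.pi / 10)) :
    saddleIntegral γ₂ ~[atTop] (fun lam : ℝ => ((√(Real.pi / (2 * lam)) : ℝ) : ℂ) *
      Complex.exp (((4 * lam / 5 - Real.pi / 4 : ℝ) : ℂ) * Complex.I)) := by
  have := isEquivalent_mul_of_tendsto (J := saddleIntegral γ₂)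
    (p := fun lam : ℝ => (starRingEnd ℂ)
      (Complex.exp ((-(4 * lam / 5) : ℝ) * Complex.I) * (√lam : ℂ)⁻¹))
    ((map_ne_zero (starRingEnd ℂ)).2 saddleConst_ne_zero)
    ((Complex.continuous_conj.tendsto _).comp tendsto_amplitudeOne) fun lam hlam => by
      obtain ⟨F, hF⟩ := exists_isPhasePrimitive lam
      obtain ⟨VE, VP, h⟩ := exists_hasValleyLimits hlam hF
      rw [saddleIntegral, (h.saddle_neg_one hF hγ).improperIntegral_eq, h.sub_eq hF hlam,
        Function.comp_apply, ← map_mul, mul_assoc]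
  refine this.congr_right (Eventually.of_forall fun lam => ?_)
  simp only
  rw [← map_mul, mul_right_comm, cexp_mul_saddleConst, sqrt_pi_div_two_mul]
  simp only [map_mul, map_inv₀, Complex.conj_ofReal, ← Complex.exp_conj, Complex.conj_I]
  push_cast
  rw [mul_neg, ← neg_mul, neg_neg]
  ring

theorem saddleIntegral_neg_I_isEquivalent
    (hγ : IsContour γ₃ (13 * Real.pi / 10) (17 * Real.pi / 10)) :
    saddleIntegral γ₃ ~[atTop] (fun lam : ℝ =>
      ((√(Real.pi / (2 * lam)) * Real.exp (-(4 * lam / 5)) : ℝ) : ℂ)) := by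
  have hA : Tendsto (fun lam => ((2 * (amplitudeNegI lam).re : ℝ) : ℂ)) atTop
      (𝓝 (√(Real.pi / 2) : ℂ)) := by
    have h1 := ((Complex.continuous_re.tendsto _).comp tendsto_amplitudeNegI).const_mul 2
    rw [Complex.ofReal_re, mul_div_cancel₀ _ two_ne_zero] at h1
    exact (Complex.continuous_ofReal.tendsto _).comp h1
  have := isEquivalent_mul_of_tendsto (J := saddleIntegral γ₃)
    (p := fun lam : ℝ => ((Real.exp (-(4 * lam / 5)) * (√lam)⁻¹ : ℝ) : ℂ))
    (Complex.ofReal_ne_zero.2 sqrt_pi_div_two_pos.ne') hA fun lam hlam => by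
      obtain ⟨F, hF⟩ := exists_isPhasePrimitive lam
      obtain ⟨VE, VP, h⟩ := exists_hasValleyLimits hlam hF
      rw [saddleIntegral, (h.saddle_neg_I hF hγ).improperIntegral_eq, h.lower_re hF hlam,
        ← Complex.ofReal_mul]
      congr 1
      ring
  refine this.congr_right (Eventually.of_forall fun lam => ?_)
  simp only
  rw [← Complex.ofReal_mul, sqrt_pi_div_two_mul]
  congr 1
  ring

theorem isBigO_exp_mul_of_isEquivalent {J₃ J : ℝ → ℂ} {θ : ℝ → ℝ}
    (h₃ : J₃ ~[atTop] fun lam : ℝ =>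
      ((√(Real.pi / (2 * lam)) * Real.exp (-(4 * lam / 5)) : ℝ) : ℂ))
    (h : J ~[atTop] fun lam : ℝ => ((√(Real.pi / (2 * lam)) : ℝ) : ℂ) *
      Complex.exp ((θ lam : ℂ) * Complex.I)) :
    J₃ =O[atTop] fun lam : ℝ => (Real.exp (-(4 * lam / 5)) : ℂ) * J lam := by
  have h1 := (isBigO_refl (fun lam : ℝ => (Real.exp (-(4 * lam / 5)) : ℂ)) atTop).mul h.isBigO_symm
  refine h₃.isBigO.trans (IsBigO.trans (IsBigO.of_bound' (Eventually.of_forall fun lam => ?_)) h1)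
  simp only [norm_mul, Complex.ofReal_mul, Complex.norm_exp_ofReal_mul_I, mul_one]
  exact (mul_comm _ _).le

end Contours

theorem mainTheorem2 :
    -- the integral defining `Q(0,0,z)` converges
    (∀ z : ℝ, z < 0 → HasImproperIntegral (swallowtailIntegrand 0 0 z) (swallowtailQ 0 0 z)) ∧
    -- leading-order asymptotics as `z → -∞`
    (fun z : ℝ => swallowtailQ 0 0 z -
        ((|z| ^ (1 / 4 : ℝ) * √(2 * Real.pi / |z| ^ (5 / 4 : ℝ)) *
          Real.cos (4 * |z| ^ (5 / 4 : ℝ) / 5 - Real.pi / 4) : ℝ) : ℂ))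
      =o[atBot] (fun z : ℝ => |z| ^ (1 / 4 : ℝ) * √(2 * Real.pi / |z| ^ (5 / 4 : ℝ))) ∧
    -- contours through the saddles `-1`, `-i`, `1`, joining consecutive valleys
    (∃ γ : ℝ → ℂ, IsSaddleContour γ (-1) (9 * Real.pi / 10) (13 * Real.pi / 10)) ∧
    (∃ γ : ℝ → ℂ, IsSaddleContour γ (-Complex.I) (13 * Real.pi / 10) (17 * Real.pi / 10)) ∧
    (∃ γ : ℝ → ℂ, IsSaddleContour γ 1 (17 * Real.pi / 10) (Real.pi / 10)) ∧
    -- the contributions of the saddles, for every choice of such contours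
    (∀ γ₂ γ₃ γ₀ : ℝ → ℂ,
      IsContour γ₂ (9 * Real.pi / 10) (13 * Real.pi / 10) →
      IsContour γ₃ (13 * Real.pi / 10) (17 * Real.pi / 10) →
      IsContour γ₀ (17 * Real.pi / 10) (Real.pi / 10) →
      (∀ lam : ℝ, 0 < lam →
        HasImproperIntegral (saddleIntegrand γ₂ lam) (saddleIntegral γ₂ lam) ∧
        HasImproperIntegral (saddleIntegrand γ₃ lam) (saddleIntegral γ₃ lam) ∧
        HasImproperIntegral (saddleIntegrand γ₀ lam) (saddleIntegral γ₀ lam)) ∧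
      (∀ z : ℝ, z < 0 →
        swallowtailQ 0 0 z = ((|z| ^ (1 / 4 : ℝ) : ℝ) : ℂ) *
          (saddleIntegral γ₂ (|z| ^ (5 / 4 : ℝ)) + saddleIntegral γ₃ (|z| ^ (5 / 4 : ℝ)) +
            saddleIntegral γ₀ (|z| ^ (5 / 4 : ℝ)))) ∧
      saddleIntegral γ₀ ~[atTop] (fun lam : ℝ => ((√(Real.pi / (2 * lam)) : ℝ) : ℂ) *
        Complex.exp (((-(4 * lam / 5) + Real.pi / 4 : ℝ) : ℂ) * Complex.I)) ∧
      saddleIntegral γ₂ ~[atTop] (fun lam : ℝ => ((√(Real.pi / (2 * lam)) : ℝ) : ℂ) *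
        Complex.exp (((4 * lam / 5 - Real.pi / 4 : ℝ) : ℂ) * Complex.I)) ∧
      saddleIntegral γ₃ ~[atTop] (fun lam : ℝ =>
        ((√(Real.pi / (2 * lam)) * Real.exp (-(4 * lam / 5)) : ℝ) : ℂ)) ∧
      -- the saddle `-i` is exponentially negligible compared to `1` and to `-1`
      saddleIntegral γ₃ =O[atTop]
        (fun lam : ℝ => (Real.exp (-(4 * lam / 5)) : ℂ) * saddleIntegral γ₀ lam) ∧
      saddleIntegral γ₃ =O[atTop]
        (fun lam : ℝ => (Real.exp (-(4 * lam / 5)) : ℂ) * saddleIntegral γ₂ lam)) ∧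
    -- the large negative zeroes, exactly one for each large index `m`
    (∃ (M : ℕ) (ζ : ℕ → ℝ),
      ζ M < 0 ∧ StrictAntiOn ζ (Set.Ici M) ∧
      {z : ℝ | z ≤ ζ M ∧ swallowtailQ 0 0 z = 0} = ζ '' Set.Ici M ∧
      Tendsto (fun m : ℕ => (4 * |ζ m| ^ (5 / 4 : ℝ) / 5 - Real.pi / 4) -
        (2 * (m : ℝ) + 1) * Real.pi / 2) atTop (𝓝 0) ∧
      ζ ~[atTop] approxNegZero) := by
  refine ⟨fun z hz => (hasImproperIntegral_swallowtail hz).self, swallowtailQ_isLittleO,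
    exists_saddleContour_neg_one, exists_saddleContour_neg_I, exists_saddleContour_one,
    fun γ₂ γ₃ γ₀ h₂ h₃ h₀ => ?_, ?_⟩
  · have e₀ := saddleIntegral_one_isEquivalent h₀
    have e₂ := saddleIntegral_neg_one_isEquivalent h₂
    have e₃ := saddleIntegral_neg_I_isEquivalent h₃
    refine ⟨fun lam hlam => ?_, fun z hz => ?_, e₀, e₂, e₃,
      isBigO_exp_mul_of_isEquivalent e₃ e₀, isBigO_exp_mul_of_isEquivalent e₃ e₂⟩
    · obtain ⟨F, hF⟩ := exists_isPhasePrimitive lam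
      obtain ⟨VE, VP, h⟩ := exists_hasValleyLimits hlam hF
      exact ⟨(h.saddle_neg_one hF h₂).self, (h.saddle_neg_I hF h₃).self, (h.saddle_one hF h₀).self⟩
    · have hlam : 0 < |z| ^ (5 / 4 : ℝ) := Real.rpow_pos_of_pos (abs_pos.2 hz.ne) _
      obtain ⟨F, hF⟩ := exists_isPhasePrimitive (|z| ^ (5 / 4 : ℝ))
      obtain ⟨VE, VP, h⟩ := exists_hasValleyLimits hlam hF
      -- What remains is `conj (VE - VP) + 2 Re VP + (VE - VP) = 2 Re VE`.
      simp only [swallowtailQ, saddleIntegral]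
      rw [(h.swallowtail hz hF).improperIntegral_eq, (h.saddle_neg_one hF h₂).improperIntegral_eq,
        (h.saddle_neg_I hF h₃).improperIntegral_eq, (h.saddle_one hF h₀).improperIntegral_eq,
        add_right_comm, add_comm ((starRingEnd ℂ) (VE - VP)), Complex.add_conj,
        ← Complex.ofReal_add, ← Complex.ofReal_mul, Complex.sub_re]
      congr 2
      ring
  · obtain ⟨N', hd, hN'⟩ := exists_deriv_normalizedQ
    refine exists_negative_zeros (fun z hz => swallowtailQ_eq hz) (fun z hz => ?_) hd
      tendsto_normalizedQ hN'
    have hz0 := abs_pos.2 hz.ne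
    have := Real.pi_pos
    positivity
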